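/- Let $a\in\mathbb{R}$, let $V\in L^1_{\mathrm{loc}}((a,\infty))$ be real-valued, and let $\tau_+=-\frac{d^2}{dx^2}+V(x)$ on $(a,\infty)$. Assume that $\tau_+$ is in the limit point case at $a$ and at $\infty$. For $z\in\mathbb{C}$, a solution of $\tau_+\psi=z\psi$ is a function $\psi$ such that $\psi,\psi'$ are locally absolutely continuous on $(a,\infty)$ and the equation holds a.e. For $z\in\mathbb{C}\setminus\mathbb{R}$ and $x_0\in(a,\infty)$ let $\psi_-(z,\cdot,x_0)$ be the unique solution that is square integrable near $a$ and satisfies $\psi_-(z,x_0,x_0)=1$, and let $m_-(z,x)=\psi_-'(z,x,x_0)/\psi_-(z,x,x_0)$, $x\in(a,\infty)$, which does not depend on $x_0$. Then the following are equivalent. (1) There are an open set $\mathcal{O}\subseteq\mathbb{C}$ containing $\mathbb{R}$ and, for each $z\in\mathcal{O}$, a solution $\widetilde\phi(z,\cdot)$ of $\tau_+\psi=z\psi$ on $(a,\infty)$ that is not identically zero, such that ($\alpha$) for every $x\in(a,\infty)$, $\widetilde\phi(\cdot,x)$ is analytic on $\mathcal{O}$; ($\beta$) $\widetilde\phi(z,x)$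 is real for all $z\in\mathbb{R}$ and $x\in(a,\infty)$; ($\gamma$) there is an $\varepsilon>0$ such that $\int_a^b|\widetilde\phi(z,x)|^2\,dx<\infty$ for all $b\in(a,\infty)$ and all $z\in\mathcal{O}\setminus\mathbb{R}$ with $|\operatorname{Im}z|<\varepsilon$. (2) For every $x\in(a,\infty)$, $m_-(\cdot,x)$ is meromorphic on $\mathbb{C}$, that is, it is the restriction to $\mathbb{C}\setminus\mathbb{R}$ of a meromorphic function on $\mathbb{C}$. -/

import Mathlib

open MeasureTheory Set

/-- `ψ` solves `-ψ'' + V ψ = z ψ` on `(a, ∞)` in the Carathéodory sense: `ψ` and `ψ'` are locally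
absolutely continuous on `(a, ∞)` and the equation holds almost everywhere there. (As `ψ'` is
continuous, `ψ` is differentiable everywhere on `(a, ∞)`, and is `C¹`.) Values of `ψ` on
`(-∞, a]` play no role. -/
structure IsSchrodingerSolution (a : ℝ) (V : ℝ → ℝ) (z : ℂ) (ψ : ℝ → ℂ) : Prop where
  differentiableAt : ∀ x, a < x → DifferentiableAt ℝ ψ x
  deriv_ac : ∀ c d, a < c → a < d → AbsolutelyContinuousOnInterval (deriv ψ) c d
  eqn : ∀ᵐ x ∂volume.restrict (Ioi a), -deriv (deriv ψ) x + (V x : ℂ) * ψ x = z * ψ x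

/-- `f` is square integrable near the left end point `a`, i.e. on `(a, b)` for all `b > a`. -/
def L2NearLeft (a : ℝ) (f : ℝ → ℂ) : Prop :=
  ∀ b, a < b → MemLp f 2 (volume.restrict (Ioo a b))

/-- `f` is square integrable near `∞`, i.e. on `(b, ∞)` for all `b > a`. -/
def L2NearInfty (a : ℝ) (f : ℝ → ℂ) : Prop :=
  ∀ b, a < b → MemLp f 2 (volume.restrict (Ioi b))

/-- Limit circle case at `a`: for some `z ∈ ℂ`, all solutions are square integrable near `a`. -/
def LimitCircleLeft (a : ℝ) (V : ℝ → ℝ) : Prop :=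
  ∃ z : ℂ, ∀ ψ : ℝ → ℂ, IsSchrodingerSolution a V z ψ → L2NearLeft a ψ

/-- Limit circle case at `∞`: for some `z ∈ ℂ`, all solutions are square integrable near `∞`. -/
def LimitCircleInfty (a : ℝ) (V : ℝ → ℝ) : Prop :=
  ∃ z : ℂ, ∀ ψ : ℝ → ℂ, IsSchrodingerSolution a V z ψ → L2NearInfty a ψ

/-- Limit point case at `a`. -/
def LimitPointLeft (a : ℝ) (V : ℝ → ℝ) : Prop := ¬ LimitCircleLeft a V

/-- Limit point case at `∞`. -/
def LimitPointInfty (a : ℝ) (V : ℝ → ℝ) : Prop := ¬ LimitCircleInfty a V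

/-- There is an analytic Weyl–Titchmarsh solution `φ(z, ·)` near `a`, for `z` in an open
neighbourhood `O` of `ℝ`: `φ(z, ·)` is a nontrivial solution for every `z ∈ O`, `φ(·, x)` is
analytic on `O`, `φ` is real for real `z`, and `φ(z, ·)` is square integrable near `a` for the
nonreal `z ∈ O` with `|Im z|` sufficiently small. -/
def HasAnalyticWeylSolution (a : ℝ) (V : ℝ → ℝ) : Prop :=
  ∃ (O : Set ℂ) (φ : ℂ → ℝ → ℂ),
    IsOpen O ∧ (∀ t : ℝ, (t : ℂ) ∈ O) ∧
    (∀ z ∈ O, IsSchrodingerSolution a V z (φ z) ∧ ∃ x, a < x ∧ φ z x ≠ 0) ∧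
    (∀ x, a < x → AnalyticOnNhd ℂ (fun z => φ z x) O) ∧
    (∀ t x : ℝ, a < x → (φ (t : ℂ) x).im = 0) ∧
    (∃ ε : ℝ, 0 < ε ∧ ∀ z ∈ O, z.im ≠ 0 → |z.im| < ε → L2NearLeft a (φ z))

/-- The Weyl–Titchmarsh solution `ψ₋(z, ·, x₀)`: the solution that is square integrable near `a`
and is normalized by `ψ₋(z, x₀, x₀) = 1`. In the limit point case at `a` it exists and is unique
on `(a, ∞)` for every nonreal `z`. -/
noncomputable def weylSolutionLeft (a : ℝ) (V : ℝ → ℝ) (z : ℂ) (x₀ : ℝ) : ℝ → ℂ :=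
  Classical.epsilon fun ψ : ℝ → ℂ =>
    IsSchrodingerSolution a V z ψ ∧ L2NearLeft a ψ ∧ ψ x₀ = 1

/-- The Weyl–Titchmarsh coefficient `m₋(z, x) = ψ₋'(z, x, x₀) / ψ₋(z, x, x₀)`, for nonreal `z`.
It does not depend on the reference point `x₀`, which is taken to be `x`. -/
noncomputable def weylMLeft (a : ℝ) (V : ℝ → ℝ) (z : ℂ) (x : ℝ) : ℂ :=
  deriv (weylSolutionLeft a V z x) x / weylSolutionLeft a V z x x

/-- A function given on `ℂ \ ℝ` is meromorphic on `ℂ`: it is the restriction to `ℂ \ ℝ` of a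
meromorphic function on `ℂ`. -/
def MeromorphicOnPlane (f : ℂ → ℂ) : Prop :=
  ∃ M : ℂ → ℂ, Meromorphic M ∧ ∀ z : ℂ, z.im ≠ 0 → M z = f z

/-! ### Absolutely continuous functions -/

/-! Fix a base point `x₀` and let `c`, `s` be the solutions with initial data `(1, 0)` and `(0, 1)`
there; both are entire in `z`. For nonreal `z` the nested Weyl discs give an `m` with `c + m s`
square integrable near `a`, and the limit point hypothesis makes it unique, so `m = m₋(z, x₀)`. The
radius estimate exhibits `m₋` as a locally uniform limit of `-c(z, b) / s(z, b)`, hence as a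
holomorphic function off the real axis (`differentiableOn_weylMLeft`).

(1) ⇒ (2): near a real point, uniqueness forces `m₋ = φ' / φ` at `x₀`, a quotient of functions
analytic in `z` (`analyticAt_deriv`).

(2) ⇒ (1): it suffices to write `m₋ = B / A` near `ℝ` with `A`, `B` holomorphic, real on `ℝ` and
without common zeros; then `φ = A c + B s` is the desired solution. No canonical product is needed:
take `A = cos θ`, `B = sin θ` with `θ = arctan m₋`. The derivative `m' / (1 + m²)` extends
holomorphically across `ℝ`, because `m` is real there and the expression is regular at poles; a
primitive on a union of discs centred on `ℝ` gives `θ` (`exists_primitive_of_real`,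
`MeromorphicOnPlane.exists_quotient`). -/

theorem AbsolutelyContinuousOnInterval.congr {X : Type*} [PseudoMetricSpace X] {f g : ℝ → X}
    {c d : ℝ} (hf : AbsolutelyContinuousOnInterval f c d) (h : EqOn f g (uIcc c d)) :
    AbsolutelyContinuousOnInterval g c d := by
  rw [absolutelyContinuousOnInterval_iff] at hf ⊢
  intro ε hε
  obtain ⟨δ, hδ, H⟩ := hf ε hε
  refine ⟨δ, hδ, fun E hE hE' => ?_⟩
  have := H E hE hE'
  rwa [Finset.sum_congr rfl fun i hi => ?_]
  rw [h (hE.1 i hi).1, h (hE.1 i hi).2]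

theorem LipschitzOnWith.comp_absolutelyContinuousOnInterval {X Y : Type*} [PseudoMetricSpace X]
    [PseudoMetricSpace Y] {K : NNReal} {F : X → Y} {s : Set X} {f : ℝ → X} {c d : ℝ}
    (hF : LipschitzOnWith K F s) (hf : AbsolutelyContinuousOnInterval f c d)
    (hs : MapsTo f (uIcc c d) s) : AbsolutelyContinuousOnInterval (fun x => F (f x)) c d := by
  rw [absolutelyContinuousOnInterval_iff] at hf ⊢
  intro ε hε
  -- Dividing by `K + 1` instead of `K` covers `K = 0`.
  obtain ⟨δ, hδ, H⟩ := hf (ε / (K + 1)) (by positivity)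
  refine ⟨δ, hδ, fun E hE hE' => ?_⟩
  have h1 := H E hE hE'
  have h2 : ∑ i ∈ Finset.range E.1, dist (F (f (E.2 i).1)) (F (f (E.2 i).2)) ≤
      K * ∑ i ∈ Finset.range E.1, dist (f (E.2 i).1) (f (E.2 i).2) := by
    rw [Finset.mul_sum]
    exact Finset.sum_le_sum fun i hi =>
      hF.dist_le_mul _ (hs (hE.1 i hi).1) _ (hs (hE.1 i hi).2)
  have h3 : 0 ≤ ∑ i ∈ Finset.range E.1, dist (f (E.2 i).1) (f (E.2 i).2) :=
    Finset.sum_nonneg fun _ _ => dist_nonneg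
  rw [lt_div_iff₀ (by positivity)] at h1
  nlinarith [K.coe_nonneg]

theorem AbsolutelyContinuousOnInterval.im {f : ℝ → ℂ} {c d : ℝ}
    (hf : AbsolutelyContinuousOnInterval f c d) :
    AbsolutelyContinuousOnInterval (fun x => (f x).im) c d :=
  (Complex.imCLM.lipschitz.lipschitzOnWith (s := univ)).comp_absolutelyContinuousOnInterval hf
    (mapsTo_univ _ _)

theorem AbsolutelyContinuousOnInterval.conj {f : ℝ → ℂ} {c d : ℝ}
    (hf : AbsolutelyContinuousOnInterval f c d) :
    AbsolutelyContinuousOnInterval (fun x => (starRingEnd ℂ) (f x)) c d :=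
  (Complex.conjCLE.toContinuousLinearMap.lipschitz.lipschitzOnWith
    (s := univ)).comp_absolutelyContinuousOnInterval hf (mapsTo_univ _ _)

theorem AbsolutelyContinuousOnInterval.ofReal {f : ℝ → ℝ} {c d : ℝ}
    (hf : AbsolutelyContinuousOnInterval f c d) :
    AbsolutelyContinuousOnInterval (fun x => (f x : ℂ)) c d :=
  (Complex.ofRealCLM.lipschitz.lipschitzOnWith
    (s := univ)).comp_absolutelyContinuousOnInterval hf (mapsTo_univ _ _)

theorem IntervalIntegrable.absolutelyContinuousOnInterval_integral_complex {f : ℝ → ℂ}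
    {c d x₀ : ℝ} (h : IntervalIntegrable f volume c d) (hx₀ : x₀ ∈ uIcc c d) :
    AbsolutelyContinuousOnInterval (fun x => ∫ t in x₀..x, f t) c d := by
  have hre : IntervalIntegrable (fun t => (f t).re) volume c d := ⟨h.1.re, h.2.re⟩
  have him : IntervalIntegrable (fun t => (f t).im) volume c d := ⟨h.1.im, h.2.im⟩
  have h1 := (hre.absolutelyContinuousOnInterval_intervalIntegral hx₀).ofReal
  have h2 := ((him.absolutelyContinuousOnInterval_intervalIntegral hx₀).ofReal).const_smul
    (Complex.I)
  refine (h1.add h2).congr fun x hx => ?_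
  have hsub : uIcc x₀ x ⊆ uIcc c d := uIcc_subset_uIcc hx₀ hx
  have hf : IntervalIntegrable f volume x₀ x := h.mono_set hsub
  have e1 : (∫ t in x₀..x, (f t).re) = (∫ t in x₀..x, f t).re := by
    simpa using Complex.reCLM.intervalIntegral_comp_comm hf
  have e2 : (∫ t in x₀..x, (f t).im) = (∫ t in x₀..x, f t).im := by
    simpa using Complex.imCLM.intervalIntegral_comp_comm hf
  simp only [Pi.add_apply, smul_eq_mul, e1, e2]
  rw [mul_comm, Complex.re_add_im]

/-! ### An exponential weight -/

/-- The integrand times `μ` is almost everywhere the derivative of `exp (μ P)`, with `P` the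
primitive of `p`. As `p` is merely integrable, the fundamental theorem is applied in its absolutely
continuous form; `exp` is Lipschitz on the bounded range of `μ P`. -/
theorem mul_integral_exp_primitive_mul {p : ℝ → ℝ} {c d x₀ : ℝ}
    (hp : IntervalIntegrable p volume c d) (hx₀ : x₀ ∈ uIcc c d) (μ : ℝ) :
    μ * ∫ t in c..d, Real.exp (μ * ∫ s in x₀..t, p s) * p t =
      Real.exp (μ * ∫ s in x₀..d, p s) - Real.exp (μ * ∫ s in x₀..c, p s) := by
  have hP := hp.absolutelyContinuousOnInterval_intervalIntegral hx₀
  obtain ⟨C, hC⟩ := (hP.const_mul μ).exists_bound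
  have hexp : ContDiffOn ℝ 1 Real.exp (Icc (-C) C) := Real.contDiff_exp.contDiffOn
  obtain ⟨K, hK⟩ := hexp.exists_lipschitzOnWith (by decide) (convex_Icc _ _) isCompact_Icc
  have hac := hK.comp_absolutelyContinuousOnInterval (hP.const_mul μ)
    fun x hx => abs_le.1 (hC x hx)
  rw [← hac.integral_deriv_eq_sub, ← intervalIntegral.integral_const_mul]
  apply intervalIntegral.integral_congr_ae
  filter_upwards [hp.ae_hasDerivAt_integral] with t ht hmem
  have h1 := ((ht (uIoc_subset_uIcc hmem) x₀ hx₀).const_mul μ).exp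
  rw [h1.deriv]
  ring

theorem abs_integral_exp_abs_primitive_mul_le {p : ℝ → ℝ} {x₀ x : ℝ} (h0 : ∀ t, 0 ≤ p t)
    (hp : IntervalIntegrable p volume x₀ x) {μ : ℝ} (hμ : 0 < μ) :
    |∫ t in x₀..x, Real.exp (μ * |∫ s in x₀..t, p s|) * p t| ≤
      Real.exp (μ * |∫ s in x₀..x, p s|) / μ := by
  rw [le_div_iff₀ hμ]
  rcases le_total x₀ x with h | h
  · have e : ∀ t ∈ uIcc x₀ x, |∫ s in x₀..t, p s| = ∫ s in x₀..t, p s := fun t ht => by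
      rw [uIcc_of_le h] at ht
      exact abs_of_nonneg (intervalIntegral.integral_nonneg ht.1 fun _ _ => h0 _)
    have e1 : ∫ t in x₀..x, Real.exp (μ * |∫ s in x₀..t, p s|) * p t =
        ∫ t in x₀..x, Real.exp (μ * ∫ s in x₀..t, p s) * p t :=
      intervalIntegral.integral_congr fun t ht => by simp only [e t ht]
    have h2 := mul_integral_exp_primitive_mul hp left_mem_uIcc μ
    rw [e1, e x right_mem_uIcc, abs_of_nonneg]
    · rw [mul_comm, h2]
      simp
    · exact intervalIntegral.integral_nonneg h fun t _ => mul_nonneg (Real.exp_pos _).le (h0 t)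
  · have e : ∀ t ∈ uIcc x₀ x, |∫ s in x₀..t, p s| = -∫ s in x₀..t, p s := fun t ht => by
      rw [uIcc_of_ge h] at ht
      rw [intervalIntegral.integral_symm t x₀, abs_neg, neg_neg]
      exact abs_of_nonneg (intervalIntegral.integral_nonneg ht.2 fun _ _ => h0 _)
    have e1 : ∫ t in x₀..x, Real.exp (μ * |∫ s in x₀..t, p s|) * p t =
        ∫ t in x₀..x, Real.exp (-μ * ∫ s in x₀..t, p s) * p t :=
      intervalIntegral.integral_congr fun t ht => by
        simp only [e t ht, mul_neg, neg_mul]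
    have h2 := mul_integral_exp_primitive_mul hp left_mem_uIcc (-μ)
    rw [e1, e x right_mem_uIcc, intervalIntegral.integral_symm, abs_neg, abs_of_nonneg]
    · have : ∫ t in x..x₀, Real.exp (-μ * ∫ s in x₀..t, p s) * p t =
        -∫ t in x₀..x, Real.exp (-μ * ∫ s in x₀..t, p s) * p t :=
          intervalIntegral.integral_symm _ _
      rw [this]
      simp only [intervalIntegral.integral_same, mul_zero, Real.exp_zero] at h2
      have h3 : μ * -∫ s in x₀..x, p s = -μ * ∫ s in x₀..x, p s := by ring
      rw [h3]
      linarith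
    · exact intervalIntegral.integral_nonneg h fun t _ => mul_nonneg (Real.exp_pos _).le (h0 t)

/-! ### Volterra operators on weighted spaces of continuous functions -/

/-- The weight `exp (μ |∫ₓ₀ˣ p|)`. -/
noncomputable def expWeight (p : ℝ → ℝ) (x₀ μ x : ℝ) : ℝ :=
  Real.exp (μ * |∫ s in x₀..x, p s|)

theorem expWeight_pos (p : ℝ → ℝ) (x₀ μ x : ℝ) : 0 < expWeight p x₀ μ x := Real.exp_pos _

theorem one_le_expWeight (p : ℝ → ℝ) (x₀ x : ℝ) {μ : ℝ} (hμ : 0 < μ) :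
    1 ≤ expWeight p x₀ μ x :=
  Real.one_le_exp (by positivity)

theorem uIcc_subset_Ioi {a c d : ℝ} (hc : a < c) (hd : a < d) : uIcc c d ⊆ Ioi a :=
  fun _ hx => lt_of_lt_of_le (lt_min hc hd) hx.1

theorem continuousOn_integral_Ioi {E : Type*} [NormedAddCommGroup E] [NormedSpace ℝ E] {a : ℝ}
    {f : ℝ → E} (hf : ∀ c d, a < c → a < d → IntervalIntegrable f volume c d) {x₀ : ℝ}
    (hx₀ : a < x₀) : ContinuousOn (fun x => ∫ t in x₀..x, f t) (Ioi a) := by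
  intro x hx
  have hx' : a < x := hx
  obtain ⟨c, hc, hc'⟩ := exists_between (lt_min hx₀ hx')
  have hd : max x₀ x < max x₀ x + 1 := lt_add_one _
  have hcd : c ≤ max x₀ x + 1 := by
    have := min_le_max (a := x₀) (b := x); linarith
  have h := intervalIntegral.continuousOn_primitive_interval' (a := x₀)
    (hf c (max x₀ x + 1) hc (by linarith))
    (by rw [uIcc_of_le hcd]
        exact ⟨(hc'.trans_le (min_le_left _ _)).le, (le_max_left _ _).trans hd.le⟩)
  rw [uIcc_of_le hcd] at h
  exact ((h x ⟨(hc'.trans_le (min_le_right _ _)).le, (le_max_right _ _).trans hd.le⟩).continuousAt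
    (Icc_mem_nhds (hc'.trans_le (min_le_right _ _))
      ((le_max_right _ _).trans_lt hd))).continuousWithinAt

theorem continuousOn_expWeight {a : ℝ} {p : ℝ → ℝ}
    (hp : ∀ c d, a < c → a < d → IntervalIntegrable p volume c d) {x₀ : ℝ} (hx₀ : a < x₀)
    (μ : ℝ) : ContinuousOn (expWeight p x₀ μ) (Ioi a) :=
  Real.continuous_exp.comp_continuousOn
    (continuousOn_const.mul (continuousOn_integral_Ioi hp hx₀).abs)

/-- Extension of a function on `(a, ∞)` by `0`. -/
noncomputable def extendIoi (a : ℝ) (h : Ioi a → ℂ) (t : ℝ) : ℂ :=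
  open Classical in if ht : a < t then h ⟨t, ht⟩ else 0

theorem extendIoi_of_lt {a t : ℝ} (h : Ioi a → ℂ) (ht : a < t) :
    extendIoi a h t = h ⟨t, ht⟩ := by simp [extendIoi, ht]

theorem continuousOn_extendIoi {a : ℝ} {h : Ioi a → ℂ} (hh : Continuous h) :
    ContinuousOn (extendIoi a h) (Ioi a) := by
  rw [continuousOn_iff_continuous_domRestrict]
  convert! hh using 1
  ext x
  simp [extendIoi_of_lt h x.2]

/-- Conjugating a Volterra operator with the weight `w = exp (μ |∫ p|)` makes its norm at most `1 /
μ` on all of `(a, ∞)`, even if `p` is not integrable near the end points: `‖q‖ w ≤ p w`, and `p w`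
integrates to at most `w / μ`. -/
theorem exists_volterra {a : ℝ} {p : ℝ → ℝ} {q : ℝ → ℂ}
    (hp : ∀ c d, a < c → a < d → IntervalIntegrable p volume c d)
    (hq : ∀ c d, a < c → a < d → IntervalIntegrable q volume c d)
    (hqp : ∀ t, ‖q t‖ ≤ p t) {x₀ μ : ℝ} (hx₀ : a < x₀) (hμ : 0 < μ) :
    ∃ J : BoundedContinuousFunction (Ioi a) ℂ →L[ℂ] BoundedContinuousFunction (Ioi a) ℂ,
      ‖J‖ ≤ 1 / μ ∧ ∀ h (x : Ioi a), (expWeight p x₀ μ x : ℂ) * J h x =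
        ∫ t in x₀..x, q t * (expWeight p x₀ μ t * extendIoi a h t) := by
  set w := expWeight p x₀ μ with hw
  have hwc : ContinuousOn (fun x => (w x : ℂ)) (Ioi a) :=
    Complex.continuous_ofReal.comp_continuousOn (continuousOn_expWeight hp hx₀ μ)
  have hw0 : ∀ x, (w x : ℂ) ≠ 0 := fun x =>
    Complex.ofReal_ne_zero.2 (expWeight_pos p x₀ μ x).ne'
  have hint : ∀ h : BoundedContinuousFunction (Ioi a) ℂ, ∀ c d, a < c → a < d →
      IntervalIntegrable (fun t => q t * (w t * extendIoi a h t)) volume c d :=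
    fun h c d hc hd => (hq c d hc hd).mul_continuousOn
      ((hwc.mul (continuousOn_extendIoi h.continuous)).mono (uIcc_subset_Ioi hc hd))
  have hcont : ∀ h : BoundedContinuousFunction (Ioi a) ℂ, Continuous fun x : Ioi a =>
      (w x : ℂ)⁻¹ * ∫ t in x₀..x, q t * (w t * extendIoi a h t) := fun h =>
    continuousOn_iff_continuous_domRestrict.1
      ((hwc.inv₀ fun x _ => hw0 x).mul (continuousOn_integral_Ioi (hint h) hx₀))
  have hbound : ∀ (h : BoundedContinuousFunction (Ioi a) ℂ) (x : Ioi a),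
      ‖(w x : ℂ)⁻¹ * ∫ t in x₀..x, q t * (w t * extendIoi a h t)‖ ≤ 1 / μ * ‖h‖ := by
    intro h x
    have hwx := expWeight_pos p x₀ μ x
    have hpw : IntervalIntegrable (fun t => w t * p t) volume x₀ x :=
      (hp x₀ x hx₀ x.2).continuousOn_mul
        ((continuousOn_expWeight hp hx₀ μ).mono (uIcc_subset_Ioi hx₀ x.2))
    have h1 : ‖∫ t in x₀..x, q t * (w t * extendIoi a h t)‖ ≤
        |∫ t in x₀..x, ‖h‖ * (w t * p t)| := by
      apply intervalIntegral.norm_integral_le_abs_of_norm_le _ (hpw.const_mul _)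
      refine (ae_restrict_mem measurableSet_uIoc).mono fun t ht => ?_
      have hat : a < t := uIcc_subset_Ioi hx₀ x.2 (uIoc_subset_uIcc ht)
      rw [extendIoi_of_lt _ hat, norm_mul, norm_mul, Complex.norm_real, Real.norm_eq_abs,
        abs_of_pos (expWeight_pos p x₀ μ t)]
      have h2 := h.norm_coe_le_norm ⟨t, hat⟩
      have h3 := hqp t
      have h4 := expWeight_pos p x₀ μ t
      calc ‖q t‖ * (w t * ‖h ⟨t, hat⟩‖) ≤ p t * (w t * ‖h‖) := by
            apply mul_le_mul h3 _ (by positivity) ((norm_nonneg _).trans h3)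
            exact mul_le_mul_of_nonneg_left h2 h4.le
        _ = ‖h‖ * (w t * p t) := by ring
    rw [intervalIntegral.integral_const_mul, abs_mul, abs_of_nonneg (norm_nonneg h)] at h1
    have h5 := abs_integral_exp_abs_primitive_mul_le
      (fun t => (norm_nonneg _).trans (hqp t)) (hp x₀ x hx₀ x.2) hμ
    have h6 : |∫ t in x₀..x, w t * p t| ≤ w x / μ := h5
    rw [norm_mul, norm_inv, Complex.norm_real, Real.norm_eq_abs, abs_of_pos hwx,
      inv_mul_le_iff₀ hwx]
    calc _ ≤ ‖h‖ * (w x / μ) := h1.trans (mul_le_mul_of_nonneg_left h6 (norm_nonneg h))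
      _ = w x * (1 / μ * ‖h‖) := by ring
  let L : BoundedContinuousFunction (Ioi a) ℂ →ₗ[ℂ] BoundedContinuousFunction (Ioi a) ℂ :=
    { toFun := fun h => BoundedContinuousFunction.ofNormedAddCommGroup _ (hcont h) _ (hbound h)
      map_add' := fun h k => by
        ext x
        simp only [BoundedContinuousFunction.coe_ofNormedAddCommGroup,
          BoundedContinuousFunction.add_apply]
        rw [← mul_add, ← intervalIntegral.integral_add (hint h _ _ hx₀ x.2)
          (hint k _ _ hx₀ x.2)]
        refine congrArg _ (intervalIntegral.integral_congr fun t ht => ?_)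
        have hat : a < t := uIcc_subset_Ioi hx₀ x.2 ht
        simp only [extendIoi_of_lt _ hat, BoundedContinuousFunction.add_apply]
        ring
      map_smul' := fun c h => by
        ext x
        simp only [BoundedContinuousFunction.coe_ofNormedAddCommGroup,
          BoundedContinuousFunction.smul_apply, RingHom.id_apply, smul_eq_mul]
        rw [mul_left_comm, ← intervalIntegral.integral_const_mul c]
        refine congrArg _ (intervalIntegral.integral_congr fun t ht => ?_)
        have hat : a < t := uIcc_subset_Ioi hx₀ x.2 ht
        simp only [extendIoi_of_lt _ hat, BoundedContinuousFunction.smul_apply, smul_eq_mul]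
        ring }
  refine ⟨L.mkContinuous (1 / μ) fun h => ?_, ?_, ?_⟩
  · exact BoundedContinuousFunction.norm_ofNormedAddCommGroup_le _ (by positivity) (hbound h)
  · exact L.mkContinuous_norm_le (by positivity) _
  · intro h x
    change (w x : ℂ) * ((w x : ℂ)⁻¹ * _) = _
    rw [mul_inv_cancel_left₀ (hw0 x)]

/-! ### Solutions of the Schrödinger equation -/

theorem LocallyIntegrableOn.intervalIntegrable_Ioi {E : Type*} [NormedAddCommGroup E] {a : ℝ}
    {f : ℝ → E} (hf : LocallyIntegrableOn f (Ioi a)) {c d : ℝ} (hc : a < c) (hd : a < d) :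
    IntervalIntegrable f volume c d :=
  ((hf.integrableOn_compact_subset (uIcc_subset_Ioi hc hd) isCompact_uIcc)).intervalIntegrable

theorem norm_extendIoi_sub_le {a : ℝ} (h k : BoundedContinuousFunction (Ioi a) ℂ) (x : ℝ) :
    ‖extendIoi a h x - extendIoi a k x‖ ≤ ‖h - k‖ := by
  by_cases hx : a < x
  · rw [extendIoi_of_lt _ hx, extendIoi_of_lt _ hx]
    exact (h - k).norm_coe_le_norm ⟨x, hx⟩
  · simp [extendIoi, hx]

theorem continuousOn_uncurry_extendIoi {a : ℝ} {s : Set ℂ}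
    {u : ℂ → BoundedContinuousFunction (Ioi a) ℂ} (hu : ContinuousOn u s) :
    ContinuousOn (fun y : ℂ × ℝ => extendIoi a (u y.1) y.2) (s ×ˢ Ioi a) := by
  rintro ⟨z, x⟩ ⟨hz, hx⟩
  have h1 : ContinuousWithinAt (fun y : ℂ × ℝ => extendIoi a (u z) y.2) (s ×ˢ Ioi a) (z, x) :=
    ContinuousWithinAt.comp (t := Ioi a) (f := Prod.snd) (x := (z, x))
      (continuousOn_extendIoi (u z).continuous x hx) continuous_snd.continuousWithinAt
      fun y hy => hy.2
  have h2 : ContinuousWithinAt (fun y : ℂ × ℝ => u y.1) (s ×ˢ Ioi a) (z, x) :=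
    ContinuousWithinAt.comp (t := s) (f := Prod.fst) (x := (z, x)) (hu z hz)
      continuous_fst.continuousWithinAt fun y hy => hy.1
  have h3 : Filter.Tendsto (fun y : ℂ × ℝ => extendIoi a (u y.1) y.2 - extendIoi a (u z) y.2)
      (nhdsWithin (z, x) (s ×ˢ Ioi a)) (nhds 0) := by
    refine squeeze_zero_norm (fun y => norm_extendIoi_sub_le (u y.1) (u z) y.2) ?_
    have h4 := (h2.tendsto.sub_const (u z)).norm
    simpa using h4
  have h5 := h3.add h1.tendsto
  simpa [ContinuousWithinAt] using h5

/-- For `‖z‖ < R` the operator `A₀ - z A₁` has norm below `1`, so `1 - (A₀ - z A₁)` is invertible,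
and inversion is holomorphic. -/
theorem exists_differentiableOn_fixedPoint {E : Type*} [NormedAddCommGroup E] [NormedSpace ℂ E]
    [CompleteSpace E] {A₀ A₁ : E →L[ℂ] E} {R : ℝ} (hR : 0 < R) (h₀ : ‖A₀‖ ≤ 1 / (1 + R))
    (h₁ : ‖A₁‖ ≤ 1 / (1 + R)) (v : E) : ∃ u : ℂ → E,
      DifferentiableOn ℂ u (Metric.ball 0 R) ∧
      ∀ z ∈ Metric.ball (0 : ℂ) R, u z = v + (A₀ (u z) - z • A₁ (u z)) := by
  have hK : ∀ z ∈ Metric.ball (0 : ℂ) R, IsUnit (1 - (A₀ - z • A₁)) := by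
    intro z hz
    rw [mem_ball_zero_iff] at hz
    refine isUnit_one_sub_of_norm_lt_one ?_
    calc ‖A₀ - z • A₁‖ ≤ ‖A₀‖ + ‖z‖ * ‖A₁‖ := by
          rw [← norm_smul]; exact norm_sub_le _ _
      _ ≤ 1 / (1 + R) + ‖z‖ * (1 / (1 + R)) := by gcongr
      _ = (1 + ‖z‖) / (1 + R) := by ring
      _ < 1 := by rw [div_lt_one (by positivity)]; linarith
  refine ⟨fun z => Ring.inverse (1 - (A₀ - z • A₁)) v, fun z hz => ?_, fun z hz => ?_⟩
  · have h1 : DifferentiableAt ℂ (fun z : ℂ => 1 - (A₀ - z • A₁)) z :=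
      (differentiableAt_const _).sub
        ((differentiableAt_const _).sub (differentiableAt_id.smul_const A₁))
    have h2 := DifferentiableAt.comp z (differentiableAt_inverse (𝕜 := ℂ) (hK z hz)) h1
    exact (h2.clm_apply (differentiableAt_const _)).differentiableWithinAt
  · have h1 := congrArg (fun T : E →L[ℂ] E => T v) (Ring.mul_inverse_cancel _ (hK z hz))
    exact eq_add_of_sub_eq h1

/-- The equation is the first order integral system for `(ψ, χ)` with `χ = ψ'`. Divided by the
weight, it becomes a fixed point equation in pairs of bounded continuous functions, affine in `z`.
-/
theorem exists_system_family {a : ℝ} {V : ℝ → ℝ} (hV : LocallyIntegrableOn V (Ioi a)) {x₀ : ℝ}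
    (hx₀ : a < x₀) (α β : ℂ) {R : ℝ} (hR : 0 < R) : ∃ ψ χ : ℂ → ℝ → ℂ,
      (∀ z, ‖z‖ < R → ∀ x, a < x → ψ z x = α + ∫ t in x₀..x, χ z t) ∧
      (∀ z, ‖z‖ < R → ∀ x, a < x → χ z x = β + ∫ t in x₀..x, ((V t : ℂ) - z) * ψ z t) ∧
      ContinuousOn (fun y : ℂ × ℝ => ψ y.1 y.2) (Metric.ball 0 R ×ˢ Ioi a) ∧
      ContinuousOn (fun y : ℂ × ℝ => χ y.1 y.2) (Metric.ball 0 R ×ˢ Ioi a) ∧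
      ∀ x, a < x → DifferentiableOn ℂ (fun z => ψ z x) (Metric.ball 0 R) := by
  -- This value makes both operator norms at most `1 / (1 + R)`, as the fixed point lemma requires;
  -- `p = 1 + |V|` dominates both kernels, `1` and `V`.
  set μ : ℝ := 1 + R with hμdef
  have hμ : 0 < μ := by positivity
  set p : ℝ → ℝ := fun t => 1 + |V t| with hpdef
  have hVi := fun c d (hc : a < c) (hd : a < d) =>
    LocallyIntegrableOn.intervalIntegrable_Ioi hV hc hd
  have hp : ∀ c d, a < c → a < d → IntervalIntegrable p volume c d := fun c d hc hd =>
    intervalIntegrable_const.add (hVi c d hc hd).abs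
  have hVc : ∀ c d, a < c → a < d → IntervalIntegrable (fun t => (V t : ℂ)) volume c d :=
    fun c d hc hd => ⟨(hVi c d hc hd).1.ofReal, (hVi c d hc hd).2.ofReal⟩
  obtain ⟨J1, hJ1, hJ1'⟩ := exists_volterra (q := fun _ => 1) hp
    (fun c d _ _ => intervalIntegrable_const) (fun t => by simp [hpdef]) hx₀ hμ
  obtain ⟨JV, hJV, hJV'⟩ := exists_volterra (q := fun t => (V t : ℂ)) hp hVc
    (fun t => by simp [hpdef]) hx₀ hμ
  set w := expWeight p x₀ μ with hw
  have hwc : ContinuousOn (fun x => (w x : ℂ)) (Ioi a) :=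
    Complex.continuous_ofReal.comp_continuousOn (continuousOn_expWeight hp hx₀ μ)
  have hw0 : ∀ x, (w x : ℂ) ≠ 0 := fun x =>
    Complex.ofReal_ne_zero.2 (expWeight_pos p x₀ μ x).ne'
  let X := BoundedContinuousFunction (Ioi a) ℂ
  let A0 : X × X →L[ℂ] X × X :=
    (J1.comp (ContinuousLinearMap.snd ℂ X X)).prod (JV.comp (ContinuousLinearMap.fst ℂ X X))
  let A1 : X × X →L[ℂ] X × X :=
    (0 : X × X →L[ℂ] X).prod (J1.comp (ContinuousLinearMap.fst ℂ X X))
  have hμ' : 0 ≤ 1 / μ := by positivity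
  have hA0 : ‖A0‖ ≤ 1 / μ := by
    refine ContinuousLinearMap.opNorm_le_bound _ hμ' fun g => ?_
    refine max_le ?_ ?_
    · exact (J1.le_of_opNorm_le hJ1 g.2).trans
        (mul_le_mul_of_nonneg_left (norm_snd_le g) hμ')
    · exact (JV.le_of_opNorm_le hJV g.1).trans
        (mul_le_mul_of_nonneg_left (norm_fst_le g) hμ')
  have hA1 : ‖A1‖ ≤ 1 / μ := by
    refine ContinuousLinearMap.opNorm_le_bound _ hμ' fun g => ?_
    refine max_le ?_ ?_
    · change ‖(0 : X)‖ ≤ _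
      rw [norm_zero]
      positivity
    · exact (J1.le_of_opNorm_le hJ1 g.1).trans
        (mul_le_mul_of_nonneg_left (norm_fst_le g) hμ')
  let W : X := BoundedContinuousFunction.ofNormedAddCommGroup (fun x : Ioi a => (w x : ℂ)⁻¹)
    (continuousOn_iff_continuous_domRestrict.1 (hwc.inv₀ fun x _ => hw0 x)) 1 fun x => by
      rw [norm_inv, Complex.norm_real, Real.norm_eq_abs, abs_of_pos (expWeight_pos p x₀ μ x)]
      exact inv_le_one_of_one_le₀ (one_le_expWeight p x₀ x hμ)
  obtain ⟨u, hu, hfix⟩ := exists_differentiableOn_fixedPoint hR hA0 hA1 (α • W, β • W)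
  have hfix1 : ∀ z ∈ Metric.ball (0 : ℂ) R, ∀ x : Ioi a,
      (u z).1 x = α * (w x : ℂ)⁻¹ + J1 (u z).2 x := by
    intro z hz x
    have h1 := congrArg (fun g : X × X => g.1 x) (hfix z hz)
    have h2 : (u z).1 x = α * (w x : ℂ)⁻¹ + (J1 (u z).2 x - z • 0) := h1
    simpa using h2
  have hfix2 : ∀ z ∈ Metric.ball (0 : ℂ) R, ∀ x : Ioi a,
      (u z).2 x = β * (w x : ℂ)⁻¹ + (JV (u z).1 x - z * J1 (u z).1 x) := by
    intro z hz x
    exact congrArg (fun g : X × X => g.2 x) (hfix z hz)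
  have hu1 : ContinuousOn (fun z => (u z).1) (Metric.ball 0 R) :=
    continuous_fst.comp_continuousOn hu.continuousOn
  have hu2 : ContinuousOn (fun z => (u z).2) (Metric.ball 0 R) :=
    continuous_snd.comp_continuousOn hu.continuousOn
  have hwc2 : ContinuousOn (fun y : ℂ × ℝ => (w y.2 : ℂ)) (Metric.ball 0 R ×ˢ Ioi a) :=
    hwc.comp continuousOn_snd fun y hy => hy.2
  refine ⟨fun z t => w t * extendIoi a (u z).1 t, fun z t => w t * extendIoi a (u z).2 t,
    fun z hz x hx => ?_, fun z hz x hx => ?_,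
    hwc2.mul (continuousOn_uncurry_extendIoi hu1), hwc2.mul (continuousOn_uncurry_extendIoi hu2),
    fun x hx => ?_⟩
  · have h1 := hfix1 z (mem_ball_zero_iff.2 hz) ⟨x, hx⟩
    have h2 := hJ1' (u z).2 ⟨x, hx⟩
    simp only [one_mul] at h2
    simp only [extendIoi_of_lt _ hx]
    rw [h1, mul_add, h2, mul_left_comm, mul_inv_cancel₀ (hw0 x), mul_one]
  · have h1 := hfix2 z (mem_ball_zero_iff.2 hz) ⟨x, hx⟩
    have h2 := hJ1' (u z).1 ⟨x, hx⟩
    have h3 := hJV' (u z).1 ⟨x, hx⟩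
    simp only [one_mul] at h2
    have hc : ContinuousOn (fun t => (w t : ℂ) * extendIoi a (u z).1 t) (uIcc x₀ x) :=
      (hwc.mul (continuousOn_extendIoi (u z).1.continuous)).mono (uIcc_subset_Ioi hx₀ hx)
    simp only [extendIoi_of_lt _ hx, sub_mul]
    rw [intervalIntegral.integral_sub ((hVc x₀ x hx₀ hx).mul_continuousOn hc)
      (hc.intervalIntegrable.const_mul z), intervalIntegral.integral_const_mul, ← h2, ← h3, h1]
    have := hw0 x
    field_simp
  · have hev : DifferentiableOn ℂ (fun z => (u z).1 ⟨x, hx⟩) (Metric.ball 0 R) :=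
      ((BoundedContinuousFunction.evalCLM ℂ (⟨x, hx⟩ : Ioi a)).comp
        (ContinuousLinearMap.fst ℂ X X)).differentiable.comp_differentiableOn hu
    simp only [extendIoi_of_lt _ hx]
    exact hev.const_mul _

/-- Countably many intervals `[a + 1/(n+1), a + n + 1]` exhaust `(a, ∞)`. -/
theorem ae_restrict_Ioi_of_forall_uIcc {a : ℝ} {P : ℝ → Prop}
    (h : ∀ c d, a < c → a < d → ∀ᵐ x, x ∈ uIcc c d → P x) :
    ∀ᵐ x ∂volume.restrict (Ioi a), P x := by
  rw [ae_restrict_iff' measurableSet_Ioi]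
  have h1 : ∀ᵐ x : ℝ, ∀ n : ℕ, x ∈ uIcc (a + 1 / ((n : ℝ) + 1)) (a + (n + 1)) → P x :=
    ae_all_iff.2 fun n => h _ _ (by have : (0:ℝ) < 1 / ((n : ℝ) + 1) := by positivity
                                    linarith) (by have : (0:ℝ) < (n : ℝ) + 1 := by positivity
                                                  linarith)
  filter_upwards [h1] with x hx hxa
  have hxa' : 0 < x - a := sub_pos.2 hxa
  obtain ⟨n, hn⟩ := exists_nat_one_div_lt hxa'
  obtain ⟨m, hm⟩ := exists_nat_gt (x - a)
  refine hx (max n m) (mem_uIcc.2 (Or.inl ⟨?_, ?_⟩))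
  · have h2 : 1 / (((max n m : ℕ) : ℝ) + 1) ≤ 1 / ((n : ℝ) + 1) := by
      apply one_div_le_one_div_of_le (by positivity)
      have : (n : ℝ) ≤ ((max n m : ℕ) : ℝ) := Nat.cast_le.2 (le_max_left _ _)
      linarith
    linarith
  · have : (m : ℝ) ≤ ((max n m : ℕ) : ℝ) := Nat.cast_le.2 (le_max_right _ _)
    linarith

theorem eq_of_absolutelyContinuous_of_ae_hasDerivAt_zero {a : ℝ} {f : ℝ → ℂ}
    (hf : ∀ c d, a < c → a < d → AbsolutelyContinuousOnInterval f c d)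
    (h0 : ∀ᵐ x, a < x → HasDerivAt f 0 x) {x y : ℝ} (hx : a < x) (hy : a < y) : f x = f y := by
  obtain ⟨C, hC⟩ := (hf x y hx hy).const_of_ae_hasDerivAt_zero
    (h0.mono fun t ht hmem => ht (uIcc_subset_Ioi hx hy hmem))
  rw [hC x left_mem_uIcc, hC y right_mem_uIcc]

/-! ### Calculus of solutions: linearity, conjugation, Wronskian, Lagrange's identity. -/

namespace IsSchrodingerSolution

variable {a : ℝ} {V : ℝ → ℝ} {z : ℂ} {φ ψ : ℝ → ℂ}

theorem hasDerivAt (h : IsSchrodingerSolution a V z ψ) {x : ℝ} (hx : a < x) :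
    HasDerivAt ψ (deriv ψ x) x := (h.differentiableAt x hx).hasDerivAt

theorem continuousOn (h : IsSchrodingerSolution a V z ψ) : ContinuousOn ψ (Ioi a) :=
  fun x hx => (h.differentiableAt x hx).continuousAt.continuousWithinAt

theorem continuousOn_deriv (h : IsSchrodingerSolution a V z ψ) :
    ContinuousOn (deriv ψ) (Ioi a) := by
  intro x hx
  have hx' : a < x := hx
  obtain ⟨c, hc, hcx⟩ := exists_between hx'
  have h1 := (h.deriv_ac c (x + 1) hc (by linarith)).continuousOn
  rw [uIcc_of_le (by linarith)] at h1
  exact ((h1 x ⟨hcx.le, by linarith⟩).continuousAt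
    (Icc_mem_nhds hcx (by linarith))).continuousWithinAt

theorem absolutelyContinuousOnInterval (h : IsSchrodingerSolution a V z ψ) {c d : ℝ}
    (hc : a < c) (hd : a < d) : AbsolutelyContinuousOnInterval ψ c d := by
  have hi : IntervalIntegrable (deriv ψ) volume c d :=
    (h.continuousOn_deriv.mono (uIcc_subset_Ioi hc hd)).intervalIntegrable
  have h1 := hi.absolutelyContinuousOnInterval_integral_complex left_mem_uIcc
  have h2 : AbsolutelyContinuousOnInterval (fun _ : ℝ => ψ c) c d :=
    ((LipschitzWith.const (ψ c)).lipschitzOnWith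
      (s := uIcc c d)).absolutelyContinuousOnInterval
  refine (h1.add h2).congr fun x hx => ?_
  have hx' := uIcc_subset_Ioi hc hd hx
  have h3 := intervalIntegral.integral_eq_sub_of_hasDerivAt
    (fun t ht => h.hasDerivAt (uIcc_subset_Ioi hc hx' ht))
    (h.continuousOn_deriv.mono (uIcc_subset_Ioi hc hx')).intervalIntegrable
  simp only [Pi.add_apply, h3]
  ring

theorem ae_hasDerivAt_deriv (h : IsSchrodingerSolution a V z ψ) :
    ∀ᵐ x, a < x → HasDerivAt (deriv ψ) (((V x : ℂ) - z) * ψ x) x := by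
  have h1 : ∀ᵐ x ∂volume.restrict (Ioi a), DifferentiableAt ℝ (deriv ψ) x :=
    ae_restrict_Ioi_of_forall_uIcc fun c d hc hd =>
      (h.deriv_ac c d hc hd).boundedVariationOn.ae_differentiableAt_of_mem_uIcc
  refine (ae_restrict_iff' measurableSet_Ioi).1 ?_
  filter_upwards [h1, h.eqn] with x hx1 hx2
  convert! hx1.hasDerivAt using 1
  linear_combination hx2

theorem of_ae_hasDerivAt {χ : ℝ → ℂ} (h1 : ∀ x, a < x → HasDerivAt ψ (χ x) x)
    (h2 : ∀ c d, a < c → a < d → AbsolutelyContinuousOnInterval χ c d)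
    (h3 : ∀ᵐ x, a < x → HasDerivAt χ (((V x : ℂ) - z) * ψ x) x) :
    IsSchrodingerSolution a V z ψ where
  differentiableAt x hx := (h1 x hx).differentiableAt
  deriv_ac c d hc hd := (h2 c d hc hd).congr fun x hx =>
    (h1 x (uIcc_subset_Ioi hc hd hx)).deriv.symm
  eqn := by
    rw [ae_restrict_iff' measurableSet_Ioi]
    filter_upwards [h3] with x hx hxa
    have : deriv ψ =ᶠ[nhds x] χ := by
      filter_upwards [Ioi_mem_nhds hxa] with t ht using (h1 t ht).deriv
    rw [this.deriv_eq, (hx hxa).deriv]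
    ring

theorem add (hφ : IsSchrodingerSolution a V z φ) (hψ : IsSchrodingerSolution a V z ψ) :
    IsSchrodingerSolution a V z (fun x => φ x + ψ x) :=
  of_ae_hasDerivAt (χ := fun x => deriv φ x + deriv ψ x)
    (fun _ hx => (hφ.hasDerivAt hx).add (hψ.hasDerivAt hx))
    (fun c d hc hd => (hφ.deriv_ac c d hc hd).add (hψ.deriv_ac c d hc hd)) (by
      filter_upwards [hφ.ae_hasDerivAt_deriv, hψ.ae_hasDerivAt_deriv] with x h1 h2 hx
      rw [mul_add]
      exact (h1 hx).add (h2 hx))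

theorem const_mul (hψ : IsSchrodingerSolution a V z ψ) (k : ℂ) :
    IsSchrodingerSolution a V z (fun x => k * ψ x) :=
  of_ae_hasDerivAt (χ := fun x => k * deriv ψ x)
    (fun _ hx => (hψ.hasDerivAt hx).const_mul k)
    (fun c d hc hd => (hψ.deriv_ac c d hc hd).const_smul k) (by
      filter_upwards [hψ.ae_hasDerivAt_deriv] with x h1 hx
      rw [mul_left_comm]
      exact (h1 hx).const_mul k)

theorem conj (hψ : IsSchrodingerSolution a V z ψ) :
    IsSchrodingerSolution a V ((starRingEnd ℂ) z) (fun x => (starRingEnd ℂ) (ψ x)) :=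
  of_ae_hasDerivAt (χ := fun x => (starRingEnd ℂ) (deriv ψ x))
    (fun _ hx => (hψ.hasDerivAt hx).star)
    (fun c d hc hd => (hψ.deriv_ac c d hc hd).conj) (by
      filter_upwards [hψ.ae_hasDerivAt_deriv] with x h1 hx
      have := (h1 hx).star
      simpa using this)

theorem deriv_conj (hψ : IsSchrodingerSolution a V z ψ) {x : ℝ} (hx : a < x) :
    deriv (fun x => (starRingEnd ℂ) (ψ x)) x = (starRingEnd ℂ) (deriv ψ x) :=
  (hψ.hasDerivAt hx).star.deriv

/-- The Wronskian of two solutions is constant. -/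
theorem wronskian_eq (hφ : IsSchrodingerSolution a V z φ) (hψ : IsSchrodingerSolution a V z ψ)
    {x y : ℝ} (hx : a < x) (hy : a < y) :
    φ x * deriv ψ x - deriv φ x * ψ x = φ y * deriv ψ y - deriv φ y * ψ y := by
  refine eq_of_absolutelyContinuous_of_ae_hasDerivAt_zero
    (f := fun x => φ x * deriv ψ x - deriv φ x * ψ x) (fun c d hc hd => ?_) ?_ hx hy
  · exact ((hφ.absolutelyContinuousOnInterval hc hd).smul (hψ.deriv_ac c d hc hd)).sub
      ((hφ.deriv_ac c d hc hd).smul (hψ.absolutelyContinuousOnInterval hc hd))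
  · filter_upwards [hφ.ae_hasDerivAt_deriv, hψ.ae_hasDerivAt_deriv] with x h1 h2 hx
    convert! ((hφ.hasDerivAt hx).mul (h2 hx)).sub ((h1 hx).mul (hψ.hasDerivAt hx)) using 1
    ring

/-- Lagrange's identity for a solution and its complex conjugate. -/
theorem im_mul_integral_norm_sq (h : IsSchrodingerSolution a V z ψ) {b x : ℝ} (hb : a < b)
    (hx : a < x) : z.im * ∫ t in b..x, ‖ψ t‖ ^ 2 =
      (deriv ψ b * (starRingEnd ℂ) (ψ b)).im - (deriv ψ x * (starRingEnd ℂ) (ψ x)).im := by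
  have hac : AbsolutelyContinuousOnInterval
      (fun t => (deriv ψ t * (starRingEnd ℂ) (ψ t)).im) b x :=
    ((h.deriv_ac b x hb hx).smul (h.absolutelyContinuousOnInterval hb hx).conj).im
  have h1 := hac.integral_deriv_eq_sub
  have h2 : ∫ t in b..x, deriv (fun t => (deriv ψ t * (starRingEnd ℂ) (ψ t)).im) t =
      ∫ t in b..x, -z.im * ‖ψ t‖ ^ 2 := by
    apply intervalIntegral.integral_congr_ae
    filter_upwards [h.ae_hasDerivAt_deriv] with t ht hmem
    have hat : a < t := uIcc_subset_Ioi hb hx (uIoc_subset_uIcc hmem)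
    have h3 := ((ht hat).mul (h.hasDerivAt hat).star)
    have h4 := Complex.imCLM.hasFDerivAt.comp_hasDerivAt t h3
    refine h4.deriv.trans ?_
    have h5 : ‖ψ t‖ ^ 2 = (ψ t).re ^ 2 + (ψ t).im ^ 2 := by
      rw [← Complex.normSq_eq_norm_sq, Complex.normSq_apply]; ring
    rw [h5]
    simp only [Complex.star_def, Complex.imCLM_apply, Complex.add_im, Complex.mul_im,
      Complex.mul_re, Complex.conj_re, Complex.conj_im, Complex.sub_re, Complex.sub_im,
      Complex.ofReal_re, Complex.ofReal_im]
    ring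
  rw [h2, intervalIntegral.integral_const_mul] at h1
  linarith

end IsSchrodingerSolution

/-! ### Existence, uniqueness and analytic dependence on the spectral parameter. -/

theorem isSchrodingerSolution_of_system {a : ℝ} {V : ℝ → ℝ}
    (hV : LocallyIntegrableOn V (Ioi a)) {x₀ : ℝ} (hx₀ : a < x₀) {z α β : ℂ} {ψ χ : ℝ → ℂ}
    (h1 : ∀ x, a < x → ψ x = α + ∫ t in x₀..x, χ t)
    (h2 : ∀ x, a < x → χ x = β + ∫ t in x₀..x, ((V t : ℂ) - z) * ψ t)
    (hψ : ContinuousOn ψ (Ioi a)) (hχ : ContinuousOn χ (Ioi a)) :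
    IsSchrodingerSolution a V z ψ ∧ ∀ x, a < x → deriv ψ x = χ x := by
  have hd : ∀ x, a < x → HasDerivAt ψ (χ x) x := by
    intro x hx
    have hi : IntervalIntegrable χ volume x₀ x :=
      (hχ.mono (uIcc_subset_Ioi hx₀ hx)).intervalIntegrable
    have h3 := (intervalIntegral.integral_hasDerivAt_right hi
      (hχ.stronglyMeasurableAtFilter isOpen_Ioi x hx)
      (hχ.continuousAt (Ioi_mem_nhds hx))).const_add α
    refine h3.congr_of_eventuallyEq ?_
    filter_upwards [Ioi_mem_nhds hx] with t ht using h1 t ht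
  have hint : ∀ c d, a < c → a < d →
      IntervalIntegrable (fun t => ((V t : ℂ) - z) * ψ t) volume c d := by
    intro c d hc hd
    have hVi := LocallyIntegrableOn.intervalIntegrable_Ioi hV hc hd
    have hVc : IntervalIntegrable (fun t => (V t : ℂ)) volume c d := ⟨hVi.1.ofReal, hVi.2.ofReal⟩
    exact (hVc.sub intervalIntegrable_const).mul_continuousOn
      (hψ.mono (uIcc_subset_Ioi hc hd))
  refine ⟨.of_ae_hasDerivAt hd (fun c d hc hd => ?_) ?_, fun x hx => (hd x hx).deriv⟩
  · have hsub : IntervalIntegrable (fun t => ((V t : ℂ) - z) * ψ t) volume c d :=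
      hint c d hc hd
    have h4 := hsub.absolutelyContinuousOnInterval_integral_complex left_mem_uIcc
    have h5 : AbsolutelyContinuousOnInterval (fun _ : ℝ => χ c) c d :=
      ((LipschitzWith.const (χ c)).lipschitzOnWith
        (s := uIcc c d)).absolutelyContinuousOnInterval
    refine (h5.add h4).congr fun x hx => ?_
    have hx' := uIcc_subset_Ioi hc hd hx
    simp only [Pi.add_apply]
    rw [h2 c hc, h2 x hx', add_assoc,
      intervalIntegral.integral_add_adjacent_intervals (hint _ _ hx₀ hc) (hint _ _ hc hx')]
  · refine (ae_restrict_iff' measurableSet_Ioi).1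
      (ae_restrict_Ioi_of_forall_uIcc fun c d hc hd => ?_)
    filter_upwards [(hint c d hc hd).ae_hasDerivAt_integral] with x hx hmem
    have h6 := (hx hmem c left_mem_uIcc).const_add (χ c)
    have hxa := uIcc_subset_Ioi hc hd hmem
    refine h6.congr_of_eventuallyEq ?_
    filter_upwards [Ioi_mem_nhds hxa] with t ht
    rw [h2 c hc, h2 t ht, add_assoc,
      intervalIntegral.integral_add_adjacent_intervals (hint _ _ hx₀ hc) (hint _ _ hc ht)]

theorem IsSchrodingerSolution.exists_of_initial {a : ℝ} {V : ℝ → ℝ}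
    (hV : LocallyIntegrableOn V (Ioi a)) {x₀ : ℝ} (hx₀ : a < x₀) (z α β : ℂ) :
    ∃ ψ, IsSchrodingerSolution a V z ψ ∧ ψ x₀ = α ∧ deriv ψ x₀ = β := by
  obtain ⟨ψ, χ, h1, h2, h3, h4, -⟩ := exists_system_family hV hx₀ α β
    (R := ‖z‖ + 1) (by positivity)
  have hz : ‖z‖ < ‖z‖ + 1 := lt_add_one _
  have hpair : ContinuousOn (fun x : ℝ => (z, x)) (Ioi a) := by fun_prop
  have hmaps : MapsTo (fun x : ℝ => (z, x)) (Ioi a) (Metric.ball 0 (‖z‖ + 1) ×ˢ Ioi a) :=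
    fun x hx => ⟨mem_ball_zero_iff.2 hz, hx⟩
  obtain ⟨h5, h6⟩ := isSchrodingerSolution_of_system hV hx₀ (h1 z hz) (h2 z hz)
    (h3.comp hpair hmaps) (h4.comp hpair hmaps)
  refine ⟨ψ z, h5, ?_, ?_⟩
  · simpa using h1 z hz x₀ hx₀
  · rw [h6 x₀ hx₀]
    simpa using h2 z hz x₀ hx₀

/-- A solution is recovered from its Wronskians with a fundamental pair of Wronskian `1`. These are
constant, so the data at `x₀` determine them. -/
theorem IsSchrodingerSolution.eqOn_of_initial {a : ℝ} {V : ℝ → ℝ}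
    (hV : LocallyIntegrableOn V (Ioi a)) {x₀ : ℝ} (hx₀ : a < x₀) {z : ℂ} {φ ψ : ℝ → ℂ}
    (hφ : IsSchrodingerSolution a V z φ) (hψ : IsSchrodingerSolution a V z ψ)
    (h0 : φ x₀ = ψ x₀) (h1 : deriv φ x₀ = deriv ψ x₀) {x : ℝ} (hx : a < x) : φ x = ψ x := by
  obtain ⟨c, hc, hc0, hc1⟩ := exists_of_initial hV hx₀ z 1 0
  obtain ⟨s, hs, hs0, hs1⟩ := exists_of_initial hV hx₀ z 0 1
  have w1 := hφ.wronskian_eq hc hx hx₀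
  have w2 := hψ.wronskian_eq hc hx hx₀
  have w3 := hφ.wronskian_eq hs hx hx₀
  have w4 := hψ.wronskian_eq hs hx hx₀
  have w5 := hc.wronskian_eq hs hx hx₀
  rw [hc0, hc1, hs0, hs1] at w5
  rw [← h0, ← h1, ← w1] at w2
  rw [← h0, ← h1, ← w3] at w4
  linear_combination (-(φ x) + ψ x) * w5 - c x * w4 + s x * w2

/-- Solutions with fixed initial data depend analytically on the spectral parameter. -/
theorem exists_solution_family {a : ℝ} {V : ℝ → ℝ} (hV : LocallyIntegrableOn V (Ioi a)) {x₀ : ℝ}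
    (hx₀ : a < x₀) (α β : ℂ) : ∃ ψ : ℂ → ℝ → ℂ,
      (∀ z, IsSchrodingerSolution a V z (ψ z)) ∧ (∀ z, ψ z x₀ = α) ∧
      (∀ z, deriv (ψ z) x₀ = β) ∧ (∀ x, a < x → Differentiable ℂ fun z => ψ z x) ∧
      ContinuousOn (fun y : ℂ × ℝ => ψ y.1 y.2) (univ ×ˢ Ioi a) := by
  choose ψ hψ hψ0 hψ1 using fun z =>
    IsSchrodingerSolution.exists_of_initial hV hx₀ z α β
  -- The families built on the balls `‖z‖ < R` agree with the chosen `ψ` by uniqueness, so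
  -- regularity in `z` can be checked ball by ball.
  have key : ∀ R : ℝ, 0 < R → ∃ χ : ℂ → ℝ → ℂ,
      (∀ z ∈ Metric.ball (0 : ℂ) R, ∀ x, a < x → ψ z x = χ z x) ∧
      ContinuousOn (fun y : ℂ × ℝ => χ y.1 y.2) (Metric.ball 0 R ×ˢ Ioi a) ∧
      ∀ x, a < x → DifferentiableOn ℂ (fun z => χ z x) (Metric.ball 0 R) := by
    intro R hR
    obtain ⟨χ, χ', h1, h2, h3, h4, h5⟩ := exists_system_family hV hx₀ α β hR
    refine ⟨χ, fun z hz x hx => ?_, h3, h5⟩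
    have hpair : ContinuousOn (fun x : ℝ => (z, x)) (Ioi a) := by fun_prop
    have hmaps : MapsTo (fun x : ℝ => (z, x)) (Ioi a) (Metric.ball 0 R ×ˢ Ioi a) :=
      fun x hx => ⟨hz, hx⟩
    rw [mem_ball_zero_iff] at hz
    obtain ⟨h5, h6⟩ := isSchrodingerSolution_of_system hV hx₀ (h1 z hz) (h2 z hz)
      (h3.comp hpair hmaps) (h4.comp hpair hmaps)
    refine (hψ z).eqOn_of_initial hV hx₀ h5 ?_ ?_ hx
    · rw [hψ0]; simpa using (h1 z hz x₀ hx₀).symm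
    · rw [hψ1, h6 x₀ hx₀]; simpa using (h2 z hz x₀ hx₀).symm
  refine ⟨ψ, hψ, hψ0, hψ1, fun x hx z => ?_, fun y hy => ?_⟩
  · obtain ⟨χ, h1, -, h3⟩ := key (‖z‖ + 1) (by positivity)
    have hz : Metric.ball (0 : ℂ) (‖z‖ + 1) ∈ nhds z :=
      Metric.isOpen_ball.mem_nhds (mem_ball_zero_iff.2 (lt_add_one _))
    refine ((h3 x hx).differentiableAt hz).congr_of_eventuallyEq ?_
    filter_upwards [hz] with w hw using h1 w hw x hx
  · obtain ⟨χ, h1, h2, -⟩ := key (‖y.1‖ + 1) (by positivity)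
    have hz : Metric.ball (0 : ℂ) (‖y.1‖ + 1) ×ˢ Ioi a ∈ nhds y :=
      (Metric.isOpen_ball.prod isOpen_Ioi).mem_nhds
        ⟨mem_ball_zero_iff.2 (lt_add_one _), hy.2⟩
    refine ((h2.continuousAt hz).congr ?_).continuousWithinAt
    filter_upwards [hz] with w hw using (h1 w.1 hw.1 w.2 hw.2).symm

/-! ### Square integrability near the left end point -/

theorem L2NearLeft.congr {a : ℝ} {f g : ℝ → ℂ} (hf : L2NearLeft a f)
    (h : ∀ x, a < x → f x = g x) : L2NearLeft a g := fun b hb =>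
  (memLp_congr_ae ((ae_restrict_mem measurableSet_Ioo).mono fun x hx => h x hx.1)).1 (hf b hb)

theorem L2NearLeft.add {a : ℝ} {f g : ℝ → ℂ} (hf : L2NearLeft a f) (hg : L2NearLeft a g) :
    L2NearLeft a (fun x => f x + g x) := fun b hb => (hf b hb).add (hg b hb)

theorem L2NearLeft.const_mul {a : ℝ} {f : ℝ → ℂ} (hf : L2NearLeft a f) (k : ℂ) :
    L2NearLeft a (fun x => k * f x) := fun b hb => (hf b hb).const_mul k

theorem L2NearLeft.conj {a : ℝ} {f : ℝ → ℂ} (hf : L2NearLeft a f) :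
    L2NearLeft a (fun x => (starRingEnd ℂ) (f x)) := fun b hb => (hf b hb).star

theorem L2NearLeft.of_integral_le {a : ℝ} {f : ℝ → ℂ} (hf : ContinuousOn f (Ioi a)) {x₀ C : ℝ}
    (hx₀ : a < x₀) (h : ∀ b, a < b → b < x₀ → ∫ t in b..x₀, ‖f t‖ ^ 2 ≤ C) : L2NearLeft a f := by
  have hcont : ContinuousOn (fun t => ‖f t‖ ^ 2) (Ioi a) := hf.norm.pow 2
  -- The points `a + (x₀ - a) / (n + 2)` tend to `a`; the shift by `2` keeps even the one for `n =
  -- 0` strictly below `x₀`.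
  have hbn : ∀ n : ℕ, a < a + (x₀ - a) / ((n : ℝ) + 2) ∧ a + (x₀ - a) / ((n : ℝ) + 2) < x₀ := by
    intro n
    have h1 : 0 < x₀ - a := sub_pos.2 hx₀
    have h2 : (0 : ℝ) < (n : ℝ) + 2 := by positivity
    constructor
    · have := div_pos h1 h2
      linarith
    · have : (x₀ - a) / ((n : ℝ) + 2) < x₀ - a := by
        rw [div_lt_iff₀ h2]
        nlinarith [(Nat.cast_nonneg n : (0 : ℝ) ≤ n)]
      linarith
  have hlim : Filter.Tendsto (fun n : ℕ => a + (x₀ - a) / ((n : ℝ) + 2)) Filter.atTop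
      (nhds a) := by
    have h1 : Filter.Tendsto (fun n : ℕ => (n : ℝ) + 2) Filter.atTop Filter.atTop :=
      Filter.tendsto_atTop_add_const_right _ _ tendsto_natCast_atTop_atTop
    simpa using (h1.const_div_atTop (x₀ - a)).const_add a
  have hint : IntegrableOn (fun t => ‖f t‖ ^ 2) (Ioc a x₀) := by
    refine integrableOn_Ioc_of_intervalIntegral_norm_bounded_left (I := C) (fun n => ?_) hlim
      (Filter.Eventually.of_forall fun n => ?_)
    · exact ((hcont.mono (fun t ht => (hbn n).1.trans_le ht.1)).integrableOn_Icc).mono_set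
        Ioc_subset_Icc_self
    · have := h _ (hbn n).1 (hbn n).2
      rw [intervalIntegral.integral_of_le (hbn n).2.le] at this
      simpa using this
  intro b hb
  have hms : AEStronglyMeasurable f (volume.restrict (Ioo a b)) :=
    (hf.mono Ioo_subset_Ioi_self).aestronglyMeasurable measurableSet_Ioo
  rw [memLp_two_iff_integrable_sq_norm hms]
  have hint2 : IntegrableOn (fun t => ‖f t‖ ^ 2) (Icc x₀ b) :=
    (hcont.mono fun t ht => hx₀.trans_le ht.1).integrableOn_Icc
  refine (hint.union hint2).mono_set fun t ht => ?_
  rcases le_total t x₀ with h1 | h1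
  · exact Or.inl ⟨ht.1, h1⟩
  · exact Or.inr ⟨h1, ht.2.le⟩

/-! ### Fundamental systems -/

/-- `c` and `s` are the solutions with initial data `(1, 0)` and `(0, 1)` at `x₀`. -/
structure IsFundamentalSystem (a : ℝ) (V : ℝ → ℝ) (x₀ : ℝ) (c s : ℂ → ℝ → ℂ) : Prop where
  lt : a < x₀
  sol_c : ∀ z, IsSchrodingerSolution a V z (c z)
  sol_s : ∀ z, IsSchrodingerSolution a V z (s z)
  c_self : ∀ z, c z x₀ = 1
  deriv_c_self : ∀ z, deriv (c z) x₀ = 0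
  s_self : ∀ z, s z x₀ = 0
  deriv_s_self : ∀ z, deriv (s z) x₀ = 1
  differentiable_c : ∀ x, a < x → Differentiable ℂ fun z => c z x
  differentiable_s : ∀ x, a < x → Differentiable ℂ fun z => s z x
  continuousOn_s : ContinuousOn (fun y : ℂ × ℝ => s y.1 y.2) (univ ×ˢ Ioi a)

theorem exists_isFundamentalSystem {a : ℝ} {V : ℝ → ℝ} (hV : LocallyIntegrableOn V (Ioi a))
    {x₀ : ℝ} (hx₀ : a < x₀) : ∃ c s, IsFundamentalSystem a V x₀ c s := by
  obtain ⟨c, h1, h2, h3, h4, -⟩ := exists_solution_family hV hx₀ 1 0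
  obtain ⟨s, k1, k2, k3, k4, k5⟩ := exists_solution_family hV hx₀ 0 1
  exact ⟨c, s, hx₀, h1, k1, h2, h3, k2, k3, h4, k4, k5⟩

namespace IsFundamentalSystem

variable {a : ℝ} {V : ℝ → ℝ} {x₀ : ℝ} {c s : ℂ → ℝ → ℂ}

theorem wronskian (F : IsFundamentalSystem a V x₀ c s) (z : ℂ) {x : ℝ} (hx : a < x) :
    c z x * deriv (s z) x - deriv (c z) x * s z x = 1 := by
  rw [(F.sol_c z).wronskian_eq (F.sol_s z) hx F.lt, F.c_self, F.deriv_c_self, F.s_self,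
    F.deriv_s_self]
  ring

theorem eq_lincomb (F : IsFundamentalSystem a V x₀ c s) {z : ℂ} {φ : ℝ → ℂ}
    (hφ : IsSchrodingerSolution a V z φ) {x : ℝ} (hx : a < x) :
    φ x = φ x₀ * c z x + deriv φ x₀ * s z x := by
  have w1 := hφ.wronskian_eq (F.sol_c z) hx F.lt
  have w2 := hφ.wronskian_eq (F.sol_s z) hx F.lt
  have w3 := F.wronskian z hx
  rw [F.c_self, F.deriv_c_self] at w1
  rw [F.s_self, F.deriv_s_self] at w2
  linear_combination (-(φ x)) * w3 + c z x * w2 - s z x * w1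

theorem sol_lincomb (F : IsFundamentalSystem a V x₀ c s) (z k l : ℂ) :
    IsSchrodingerSolution a V z (fun x => k * c z x + l * s z x) :=
  ((F.sol_c z).const_mul k).add ((F.sol_s z).const_mul l)

theorem sol_add_mul (F : IsFundamentalSystem a V x₀ c s) (z m : ℂ) :
    IsSchrodingerSolution a V z (fun x => c z x + m * s z x) :=
  (F.sol_c z).add ((F.sol_s z).const_mul m)

theorem deriv_add_mul (F : IsFundamentalSystem a V x₀ c s) (z m : ℂ) {x : ℝ} (hx : a < x) :
    deriv (fun x => c z x + m * s z x) x = deriv (c z) x + m * deriv (s z) x :=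
  (((F.sol_c z).hasDerivAt hx).add (((F.sol_s z).hasDerivAt hx).const_mul m)).deriv

theorem continuousOn_norm_sq (F : IsFundamentalSystem a V x₀ c s) (z m : ℂ) :
    ContinuousOn (fun t => ‖c z t + m * s z t‖ ^ 2) (Ioi a) :=
  (F.sol_add_mul z m).continuousOn.norm.pow 2

/-- If `s` vanished on an interval, so would its derivative inside, against the Wronskian being `1`.
-/
theorem exists_s_ne_zero (F : IsFundamentalSystem a V x₀ c s) (z : ℂ) {b d : ℝ} (hb : a < b)
    (hbd : b < d) : ∃ t ∈ Ioo b d, s z t ≠ 0 := by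
  by_contra! H
  obtain ⟨t, ht⟩ := exists_between hbd
  have hta : a < t := hb.trans ht.1
  have h1 : s z =ᶠ[nhds t] fun _ => 0 := by
    filter_upwards [Ioo_mem_nhds ht.1 ht.2] with u hu using H u hu
  have h2 := F.wronskian z hta
  rw [h1.deriv_eq, H t ht] at h2
  simp at h2

theorem integral_s_pos (F : IsFundamentalSystem a V x₀ c s) (z : ℂ) {b : ℝ} (hb : a < b)
    (hb' : b < x₀) : 0 < ∫ t in b..x₀, ‖s z t‖ ^ 2 := by
  obtain ⟨t, ht, ht0⟩ := F.exists_s_ne_zero z hb hb'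
  exact intervalIntegral.integral_pos hb'
    (((F.sol_s z).continuousOn.norm.pow 2).mono fun t ht => hb.trans_le ht.1)
    (fun t _ => by positivity) ⟨t, Ioo_subset_Icc_self ht, by positivity⟩

/-! ### Lagrange's identity on `[b, x₀]` and the Weyl discs. -/

theorem im_mul_integral_s (F : IsFundamentalSystem a V x₀ c s) (z : ℂ) {b : ℝ} (hb : a < b) :
    z.im * ∫ t in b..x₀, ‖s z t‖ ^ 2 = (deriv (s z) b * (starRingEnd ℂ) (s z b)).im := by
  rw [(F.sol_s z).im_mul_integral_norm_sq hb F.lt, F.s_self]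
  simp

theorem im_mul_integral_add_mul (F : IsFundamentalSystem a V x₀ c s) (z m : ℂ) {b : ℝ}
    (hb : a < b) : z.im * ∫ t in b..x₀, ‖c z t + m * s z t‖ ^ 2 =
      ((deriv (c z) b + m * deriv (s z) b) * (starRingEnd ℂ) (c z b + m * s z b)).im - m.im := by
  rw [(F.sol_add_mul z m).im_mul_integral_norm_sq hb F.lt, F.deriv_add_mul z m hb,
    F.deriv_add_mul z m F.lt, F.c_self, F.s_self, F.deriv_c_self, F.deriv_s_self]
  simp

/-- A zero at `b` would make the nonreal `z` a Dirichlet eigenvalue on `[b, x₀]`. -/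
theorem s_ne_zero (F : IsFundamentalSystem a V x₀ c s) {z : ℂ} (hz : z.im ≠ 0) {b : ℝ}
    (hb : a < b) (hb' : b < x₀) : s z b ≠ 0 := by
  intro h
  have h1 := F.im_mul_integral_s z hb
  rw [h] at h1
  simp only [map_zero, mul_zero, Complex.zero_im, mul_eq_zero] at h1
  exact h1.elim hz (F.integral_s_pos z hb hb').ne'

/-- The Weyl disc of a base point `b` left of `x₀`. -/
def weylDisc (_F : IsFundamentalSystem a V x₀ c s) (z : ℂ) (b : ℝ) : Set ℂ :=
  {m | ∫ t in b..x₀, ‖c z t + m * s z t‖ ^ 2 ≤ -m.im / z.im}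

/-- Lagrange's identity turns the integral condition into a quadratic condition on the boundary
values at `b`, from which closedness and the radius can be read off. -/
theorem mem_weylDisc_iff (F : IsFundamentalSystem a V x₀ c s) {z m : ℂ} (hz : z.im ≠ 0) {b : ℝ}
    (hb : a < b) : m ∈ F.weylDisc z b ↔
      ((deriv (c z) b + m * deriv (s z) b) *
        (starRingEnd ℂ) (c z b + m * s z b)).im / z.im ≤ 0 := by
  have h1 := F.im_mul_integral_add_mul z m hb
  have h2 : ∫ t in b..x₀, ‖c z t + m * s z t‖ ^ 2 =
      ((deriv (c z) b + m * deriv (s z) b) *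
        (starRingEnd ℂ) (c z b + m * s z b)).im / z.im + -m.im / z.im := by
    rw [← add_div, ← sub_eq_add_neg, ← h1, mul_div_cancel_left₀ _ hz]
  rw [weylDisc, mem_ofPred_eq, h2]
  constructor <;> intro h <;> linarith

theorem isClosed_weylDisc (F : IsFundamentalSystem a V x₀ c s) {z : ℂ} (hz : z.im ≠ 0) {b : ℝ}
    (hb : a < b) : IsClosed (F.weylDisc z b) := by
  have : F.weylDisc z b = {m | ((deriv (c z) b + m * deriv (s z) b) *
        (starRingEnd ℂ) (c z b + m * s z b)).im / z.im ≤ 0} :=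
    ext fun m => F.mem_weylDisc_iff hz hb
  rw [this]
  refine isClosed_le ?_ continuous_const
  refine (Complex.continuous_im.comp ?_).div_const _
  exact (by fun_prop : Continuous fun m : ℂ => deriv (c z) b + m * deriv (s z) b).mul
    (Complex.continuous_conj.comp (by fun_prop))

theorem weylDisc_mono (F : IsFundamentalSystem a V x₀ c s) (z : ℂ) {b d : ℝ} (hb : a < b)
    (hbd : b ≤ d) (hd : d ≤ x₀) : F.weylDisc z b ⊆ F.weylDisc z d := by
  intro m hm
  change ∫ t in b..x₀, ‖c z t + m * s z t‖ ^ 2 ≤ -m.im / z.im at hm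
  refine le_trans ?_ hm
  refine intervalIntegral.integral_mono_interval hbd hd le_rfl
    (Filter.Eventually.of_forall fun t => by positivity) ?_
  exact ((F.continuousOn_norm_sq z m).mono (uIcc_subset_Ioi hb F.lt)).intervalIntegrable

/-- For this `m` the solution `c + m s` vanishes at `b`, so the quadratic expression is zero: the
point lies on the bounding circle. -/
theorem dirichlet_mem_weylDisc (F : IsFundamentalSystem a V x₀ c s) {z : ℂ} (hz : z.im ≠ 0)
    {b : ℝ} (hb : a < b) (hb' : b < x₀) : -c z b / s z b ∈ F.weylDisc z b := by
  rw [F.mem_weylDisc_iff hz hb, div_mul_cancel₀ _ (F.s_ne_zero hz hb hb')]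
  simp

/-- The bound is the diameter of the disc. With `m` displaced by `δ` from the Dirichlet point, the
quadratic condition has no constant term; its linear part has modulus at most `‖δ‖ / |Im z|`, by the
Wronskian, and its quadratic part is `‖δ‖² ∫ |s|²`. -/
theorem norm_sub_le_of_mem_weylDisc (F : IsFundamentalSystem a V x₀ c s) {z m : ℂ}
    (hz : z.im ≠ 0) {b : ℝ} (hb : a < b) (hb' : b < x₀) (hm : m ∈ F.weylDisc z b) :
    ‖-c z b / s z b - m‖ ≤ 1 / (|z.im| * ∫ t in b..x₀, ‖s z t‖ ^ 2) := by
  have hs := F.s_ne_zero hz hb hb'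
  have hI := F.integral_s_pos z hb hb'
  have hE := F.im_mul_integral_s z hb
  have hW := F.wronskian z hb
  rw [F.mem_weylDisc_iff hz hb] at hm
  set I := ∫ t in b..x₀, ‖s z t‖ ^ 2
  set δ := m - -c z b / s z b with hδ
  have hm' : m = -c z b / s z b + δ := by rw [hδ]; ring
  set k := deriv (c z) b + -c z b / s z b * deriv (s z) b with hk
  have hks : k * s z b = -1 := by
    rw [hk]; field_simp; linear_combination -hW
  have e1 : c z b + m * s z b = δ * s z b := by
    rw [hm']; field_simp; ring
  have e2 : deriv (c z) b + m * deriv (s z) b = k + δ * deriv (s z) b := by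
    rw [hm', hk]; ring
  have e3 : (k + δ * deriv (s z) b) * (starRingEnd ℂ) (δ * s z b) =
      k * (starRingEnd ℂ) (s z b) * (starRingEnd ℂ) δ +
        ((‖δ‖ ^ 2 : ℝ) : ℂ) * (deriv (s z) b * (starRingEnd ℂ) (s z b)) := by
    have : ((‖δ‖ ^ 2 : ℝ) : ℂ) = δ * (starRingEnd ℂ) δ := by
      rw [Complex.mul_conj, Complex.normSq_eq_norm_sq]
    rw [this, map_mul]; ring
  rw [e1, e2, e3, Complex.add_im, Complex.im_ofReal_mul, ← hE, add_div] at hm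
  have h1 : ‖k * (starRingEnd ℂ) (s z b) * (starRingEnd ℂ) δ‖ = ‖δ‖ := by
    have := congrArg norm hks
    rw [norm_mul, norm_neg, norm_one] at this
    rw [norm_mul, norm_mul, Complex.norm_conj, Complex.norm_conj, this, one_mul]
  have h2 := (Complex.abs_im_le_norm (k * (starRingEnd ℂ) (s z b) * (starRingEnd ℂ) δ)).trans_eq h1
  have hza : 0 < |z.im| := abs_pos.2 hz
  have h3 : ‖δ‖ ^ 2 * (z.im * I) / z.im = ‖δ‖ ^ 2 * I := by
    field_simp
  rw [h3] at hm
  have h4 : -(‖δ‖ / |z.im|) ≤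
      (k * (starRingEnd ℂ) (s z b) * (starRingEnd ℂ) δ).im / z.im := by
    have h5 : |(k * (starRingEnd ℂ) (s z b) * (starRingEnd ℂ) δ).im / z.im| ≤ ‖δ‖ / |z.im| := by
      rw [abs_div]
      gcongr
    exact (abs_le.1 h5).1
  have h6 : ‖δ‖ * (‖δ‖ * I) ≤ ‖δ‖ / |z.im| := by nlinarith
  rw [norm_sub_rev, ← hδ, le_div_iff₀ (by positivity)]
  rw [le_div_iff₀ hza] at h6
  rcases (norm_nonneg δ).eq_or_lt with h0 | h0
  · rw [← h0]; simp
  · by_contra! H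
    nlinarith

/-- The discs are nonempty, compact and decrease as `b` decreases to `a`, so they have a common
point. -/
theorem exists_mem_weylDisc (F : IsFundamentalSystem a V x₀ c s) {z : ℂ} (hz : z.im ≠ 0) :
    ∃ m, ∀ b, a < b → b < x₀ → m ∈ F.weylDisc z b := by
  have hlt := F.lt
  obtain ⟨b, hb_anti, hb_mem, hb_lim⟩ := exists_seq_strictAnti_tendsto' hlt
  have hne : (⋂ n, F.weylDisc z (b n)).Nonempty := by
    refine IsCompact.nonempty_iInter_of_sequence_nonempty_isCompact_isClosed _
      (fun n => F.weylDisc_mono z (hb_mem _).1 (hb_anti (Nat.lt_succ_self n)).le (hb_mem _).2.le)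
      (fun n => ⟨_, F.dirichlet_mem_weylDisc hz (hb_mem n).1 (hb_mem n).2⟩) ?_
      fun n => F.isClosed_weylDisc hz (hb_mem n).1
    refine Metric.isCompact_of_isClosed_isBounded (F.isClosed_weylDisc hz (hb_mem 0).1) ?_
    refine Metric.isBounded_closedBall.subset (fun m hm => ?_)
      (t := Metric.closedBall (-c z (b 0) / s z (b 0))
        (1 / (|z.im| * ∫ t in (b 0)..x₀, ‖s z t‖ ^ 2)))
    rw [mem_closedBall_iff_norm, norm_sub_rev]
    exact F.norm_sub_le_of_mem_weylDisc hz (hb_mem 0).1 (hb_mem 0).2 hm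
  obtain ⟨m, hm⟩ := hne
  refine ⟨m, fun d hd hd' => ?_⟩
  obtain ⟨n, hn⟩ := (hb_lim.eventually (gt_mem_nhds hd)).exists
  exact F.weylDisc_mono z (hb_mem n).1 hn.le hd'.le (mem_iInter.1 hm n)

theorem l2NearLeft_of_mem_weylDisc (F : IsFundamentalSystem a V x₀ c s) {z m : ℂ}
    (hm : ∀ b, a < b → b < x₀ → m ∈ F.weylDisc z b) :
    L2NearLeft a (fun x => c z x + m * s z x) :=
  .of_integral_le (F.sol_add_mul z m).continuousOn F.lt hm

/-- Some `c + m s` is always square integrable near `a`. If `s` were too, every solution for this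
`z` would be, and one such `z` already means limit circle. -/
theorem not_l2NearLeft_s (F : IsFundamentalSystem a V x₀ c s) (hlp : LimitPointLeft a V) {z : ℂ}
    (hz : z.im ≠ 0) : ¬ L2NearLeft a (s z) := by
  intro hs
  obtain ⟨m, hm⟩ := F.exists_mem_weylDisc hz
  have hm := F.l2NearLeft_of_mem_weylDisc hm
  have hc : L2NearLeft a (c z) := (hm.add (hs.const_mul (-m))).congr fun x _ => by ring
  exact hlp ⟨z, fun ψ hψ => ((hc.const_mul (ψ x₀)).add (hs.const_mul (deriv ψ x₀))).congr
    fun x hx => (F.eq_lincomb hψ hx).symm⟩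

/-- In the limit point case the Weyl discs shrink to a point. -/
theorem exists_lt_integral_s (F : IsFundamentalSystem a V x₀ c s) (hlp : LimitPointLeft a V)
    {z : ℂ} (hz : z.im ≠ 0) (K : ℝ) : ∃ b, a < b ∧ b < x₀ ∧ K < ∫ t in b..x₀, ‖s z t‖ ^ 2 := by
  by_contra! H
  exact F.not_l2NearLeft_s hlp hz (.of_integral_le (F.sol_s z).continuousOn F.lt H)

/-! ### The Weyl coefficient: uniqueness, symmetry, holomorphy. -/

theorem eq_of_l2NearLeft (F : IsFundamentalSystem a V x₀ c s) (hlp : LimitPointLeft a V)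
    {z m n : ℂ} (hz : z.im ≠ 0) (hm : L2NearLeft a (fun x => c z x + m * s z x))
    (hn : L2NearLeft a (fun x => c z x + n * s z x)) : m = n := by
  by_contra hne
  refine F.not_l2NearLeft_s hlp hz
    (((hm.add (hn.const_mul (-1))).const_mul (m - n)⁻¹).congr fun x _ => ?_)
  have := sub_ne_zero.2 hne
  field_simp
  ring

theorem apply_ne_zero_of_l2NearLeft (F : IsFundamentalSystem a V x₀ c s)
    (hlp : LimitPointLeft a V) {z : ℂ} (hz : z.im ≠ 0) {φ : ℝ → ℂ}
    (hφ : IsSchrodingerSolution a V z φ) (hφ2 : L2NearLeft a φ) (h0 : ∃ x, a < x ∧ φ x ≠ 0) :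
    φ x₀ ≠ 0 := by
  intro h
  obtain ⟨x, hx, hx0⟩ := h0
  have h1 : ∀ x, a < x → φ x = deriv φ x₀ * s z x := fun x hx => by
    rw [F.eq_lincomb hφ hx, h]; ring
  have h2 : deriv φ x₀ ≠ 0 := fun h3 => hx0 (by rw [h1 x hx, h3, zero_mul])
  exact F.not_l2NearLeft_s hlp hz ((hφ2.const_mul (deriv φ x₀)⁻¹).congr fun x hx => by
    rw [h1 x hx]; field_simp)

theorem l2NearLeft_div (F : IsFundamentalSystem a V x₀ c s) {z : ℂ} {φ : ℝ → ℂ}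
    (hφ : IsSchrodingerSolution a V z φ) (hφ2 : L2NearLeft a φ) (h0 : φ x₀ ≠ 0) :
    L2NearLeft a (fun x => c z x + deriv φ x₀ / φ x₀ * s z x) :=
  (hφ2.const_mul (φ x₀)⁻¹).congr fun x hx => by
    rw [F.eq_lincomb hφ hx]; field_simp

theorem weylMLeft_spec (F : IsFundamentalSystem a V x₀ c s) {z : ℂ} (hz : z.im ≠ 0) :
    L2NearLeft a (fun x => c z x + weylMLeft a V z x₀ * s z x) := by
  obtain ⟨m, hm⟩ := F.exists_mem_weylDisc hz
  have h := Classical.epsilon_spec (p := fun ψ : ℝ → ℂ =>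
      IsSchrodingerSolution a V z ψ ∧ L2NearLeft a ψ ∧ ψ x₀ = 1)
    ⟨_, F.sol_add_mul z m, F.l2NearLeft_of_mem_weylDisc hm, by simp [F.c_self, F.s_self]⟩
  exact F.l2NearLeft_div h.1 h.2.1 (h.2.2.trans_ne one_ne_zero)

theorem weylMLeft_eq (F : IsFundamentalSystem a V x₀ c s) (hlp : LimitPointLeft a V) {z : ℂ}
    (hz : z.im ≠ 0) {φ : ℝ → ℂ} (hφ : IsSchrodingerSolution a V z φ) (hφ2 : L2NearLeft a φ)
    (h0 : ∃ x, a < x ∧ φ x ≠ 0) : weylMLeft a V z x₀ = deriv φ x₀ / φ x₀ :=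
  F.eq_of_l2NearLeft hlp hz (F.weylMLeft_spec hz)
    (F.l2NearLeft_div hφ hφ2 (F.apply_ne_zero_of_l2NearLeft hlp hz hφ hφ2 h0))

theorem weylMLeft_conj (F : IsFundamentalSystem a V x₀ c s) (hlp : LimitPointLeft a V) {z : ℂ}
    (hz : z.im ≠ 0) :
    weylMLeft a V ((starRingEnd ℂ) z) x₀ = (starRingEnd ℂ) (weylMLeft a V z x₀) := by
  have hsol := F.sol_add_mul z (weylMLeft a V z x₀)
  have h1 : (starRingEnd ℂ) (c z x₀ + weylMLeft a V z x₀ * s z x₀) = 1 := by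
    simp [F.c_self, F.s_self]
  rw [F.weylMLeft_eq hlp (by simpa using hz) hsol.conj (F.weylMLeft_spec hz).conj
    ⟨x₀, F.lt, h1.trans_ne one_ne_zero⟩, hsol.deriv_conj F.lt, h1, div_one,
    F.deriv_add_mul z _ F.lt, F.deriv_c_self, F.deriv_s_self]
  simp

theorem weylMLeft_mem_weylDisc (F : IsFundamentalSystem a V x₀ c s) (hlp : LimitPointLeft a V)
    {z : ℂ} (hz : z.im ≠ 0) {b : ℝ} (hb : a < b) (hb' : b < x₀) :
    weylMLeft a V z x₀ ∈ F.weylDisc z b := by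
  obtain ⟨m, hm⟩ := F.exists_mem_weylDisc hz
  rw [F.eq_of_l2NearLeft hlp hz (F.weylMLeft_spec hz) (F.l2NearLeft_of_mem_weylDisc hm)]
  exact hm b hb hb'

theorem continuous_integral_s (F : IsFundamentalSystem a V x₀ c s) {b : ℝ} (hb : a < b)
    (hb' : b < x₀) : Continuous fun z => ∫ t in b..x₀, ‖s z t‖ ^ 2 := by
  -- Clamping the variable at `b` gives a function continuous on the whole product, unchanged on
  -- `[b, x₀]`.
  have h1 : Continuous fun y : ℂ × ℝ => s y.1 (max b y.2) := by
    rw [← continuousOn_univ]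
    exact F.continuousOn_s.comp (f := fun y : ℂ × ℝ => (y.1, max b y.2))
      (by fun_prop : Continuous fun y : ℂ × ℝ => (y.1, max b y.2)).continuousOn
      fun y _ => ⟨mem_univ _, hb.trans_le (le_max_left _ _)⟩
  have h3 : Continuous fun y : ℂ × ℝ => ‖s y.1 (max b y.2)‖ ^ 2 := h1.norm.pow 2
  have h2 := intervalIntegral.continuous_parametric_intervalIntegral_of_continuous' (μ := volume)
    (f := fun z t => ‖s z (max b t)‖ ^ 2) h3 b x₀
  refine h2.congr fun z => intervalIntegral.integral_congr fun t ht => ?_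
  rw [uIcc_of_le hb'.le] at ht
  simp only [max_eq_right ht.1]

/-- The coefficient and the holomorphic Dirichlet quotients `-c / s` at `b n` lie in the same Weyl
disc, whose diameter tends to `0` locally uniformly. -/
theorem differentiableOn_weylMLeft (F : IsFundamentalSystem a V x₀ c s)
    (hlp : LimitPointLeft a V) :
    DifferentiableOn ℂ (fun z => weylMLeft a V z x₀) {z | z.im ≠ 0} := by
  obtain ⟨b, -, hb_mem, hb_lim⟩ := exists_seq_strictAnti_tendsto' F.lt
  have hopen : IsOpen {z : ℂ | z.im ≠ 0} := isOpen_ne_fun Complex.continuous_im continuous_const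
  refine TendstoLocallyUniformlyOn.differentiableOn (φ := Filter.atTop)
    (F := fun n z => -c z (b n) / s z (b n)) ?_ (Filter.Eventually.of_forall fun n z hz => ?_) hopen
  · rw [Metric.tendstoLocallyUniformlyOn_iff]
    intro ε hε z hz
    have hza : 0 < |z.im| := abs_pos.2 hz
    -- A `d` that makes the disc small at `z` does so on a neighbourhood of `z` by continuity. The
    -- integral grows as its lower end decreases, so every `b n < d` works there as well.
    obtain ⟨d, hd, hd', hK⟩ := F.exists_lt_integral_s hlp hz (1 / ε / |z.im|)
    rw [div_lt_iff₀' hza] at hK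
    have hcont : Continuous fun w : ℂ => |w.im| * ∫ t in d..x₀, ‖s w t‖ ^ 2 :=
      Complex.continuous_im.abs.mul (F.continuous_integral_s hd hd')
    refine ⟨_, mem_nhdsWithin_of_mem_nhds (hcont.continuousAt.eventually (lt_mem_nhds hK)), ?_⟩
    filter_upwards [hb_lim.eventually (gt_mem_nhds hd)] with n hn w hw
    change 1 / ε < |w.im| * ∫ t in d..x₀, ‖s w t‖ ^ 2 at hw
    have hε' : 0 < 1 / ε := by positivity
    have hw0 : w.im ≠ 0 := by
      rintro h
      rw [h, abs_zero, zero_mul] at hw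
      exact hw.not_gt hε'
    have h1 := F.norm_sub_le_of_mem_weylDisc hw0 (hb_mem n).1 (hb_mem n).2
      (F.weylMLeft_mem_weylDisc hlp hw0 (hb_mem n).1 (hb_mem n).2)
    have h2 : ∫ t in d..x₀, ‖s w t‖ ^ 2 ≤ ∫ t in (b n)..x₀, ‖s w t‖ ^ 2 :=
      intervalIntegral.integral_mono_interval hn.le hd'.le le_rfl
        (Filter.Eventually.of_forall fun t => by positivity)
        (((F.sol_s w).continuousOn.norm.pow 2).mono
          (uIcc_subset_Ioi (hb_mem n).1 F.lt)).intervalIntegrable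
    rw [dist_eq_norm, norm_sub_rev]
    refine h1.trans_lt ?_
    have h3 : 1 / ε < |w.im| * ∫ t in (b n)..x₀, ‖s w t‖ ^ 2 :=
      hw.trans_le (mul_le_mul_of_nonneg_left h2 (abs_nonneg _))
    rwa [one_div_lt (hε'.trans h3) hε]
  · exact (((F.differentiable_c _ (hb_mem n).1) z).neg.div ((F.differentiable_s _ (hb_mem n).1) z)
      (F.s_ne_zero hz (hb_mem n).1 (hb_mem n).2)).differentiableWithinAt

end IsFundamentalSystem

/-! ### Meromorphic functions that are real on the real axis -/

/-- Compare the limits along `t + iε` and `t - iε`. -/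
theorem im_eq_zero_of_conj_symm {F : ℂ → ℂ} {t : ℝ} (hF : ContinuousAt F t)
    (hconj : ∀ z : ℂ, z.im ≠ 0 → F ((starRingEnd ℂ) z) = (starRingEnd ℂ) (F z)) :
    (F t).im = 0 := by
  have h1 : Filter.Tendsto (fun ε : ℝ => (t : ℂ) + ε * Complex.I) (nhdsWithin 0 (Ioi 0))
      (nhds t) := by
    have : Continuous fun ε : ℝ => (t : ℂ) + ε * Complex.I := by fun_prop
    simpa using (this.tendsto 0).mono_left (nhdsWithin_le_nhds (s := Ioi 0))
  have h2 : Filter.Tendsto (fun ε : ℝ => (t : ℂ) - ε * Complex.I) (nhdsWithin 0 (Ioi 0))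
      (nhds t) := by
    have : Continuous fun ε : ℝ => (t : ℂ) - ε * Complex.I := by fun_prop
    simpa using (this.tendsto 0).mono_left (nhdsWithin_le_nhds (s := Ioi 0))
  have h3 := hF.tendsto.comp h2
  have h4 := (Complex.continuous_conj.tendsto _).comp (hF.tendsto.comp h1)
  refine Complex.conj_eq_iff_im.1 (tendsto_nhds_unique (h4.congr' ?_) h3)
  filter_upwards [self_mem_nhdsWithin] with ε hε
  have hε' : (0 : ℝ) < ε := hε
  have h5 := hconj ((t : ℂ) + ε * Complex.I) (by simpa using hε'.ne')
  simp only [Function.comp_apply]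
  rw [← h5]
  simp [sub_eq_add_neg]

theorem im_deriv_eq_zero {F : ℂ → ℂ} {t : ℝ} (hF : DifferentiableAt ℂ F t)
    (h : ∀ᶠ u : ℝ in nhds t, (F u).im = 0) : (deriv F t).im = 0 := by
  have h1 := Complex.imCLM.hasFDerivAt.comp_hasDerivAt t hF.hasDerivAt.comp_ofReal
  have h2 : HasDerivAt (fun u : ℝ => (F u).im) (deriv F t).im t := h1
  have h3 : (fun u : ℝ => (F u).im) =ᶠ[nhds t] fun _ => 0 := h
  rw [← h2.deriv, h3.deriv_eq, deriv_const]

/-- A quotient `B / A` representing `N` near a real point, where `A` and `B` are real on the real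
axis and have no common zeros. -/
structure IsLocalQuotient (N : ℂ → ℂ) (t : ℝ) (r : ℝ) (A B : ℂ → ℂ) : Prop where
  differentiableOn_left : DifferentiableOn ℂ A (Metric.ball t r)
  differentiableOn_right : DifferentiableOn ℂ B (Metric.ball t r)
  ne_zero : ∀ z ∈ Metric.ball (t : ℂ) r, A z ^ 2 + B z ^ 2 ≠ 0
  real_left : ∀ u : ℝ, (u : ℂ) ∈ Metric.ball (t : ℂ) r → (A u).im = 0
  real_right : ∀ u : ℝ, (u : ℂ) ∈ Metric.ball (t : ℂ) r → (B u).im = 0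
  left_ne_zero : ∀ z ∈ Metric.ball (t : ℂ) r, z ≠ t → A z ≠ 0
  eq_mul : ∀ z ∈ Metric.ball (t : ℂ) r, z ≠ t → B z = N z * A z

theorem one_add_sq_ne_zero_of_im_eq_zero {w : ℂ} (hw : w.im = 0) : 1 + w ^ 2 ≠ 0 := by
  intro h
  have h1 := congrArg Complex.re h
  simp [pow_two, hw] at h1
  nlinarith [mul_self_nonneg w.re]

/-- Take `(1, N)` where `N` is analytic and `(1/N, 1)` at a pole. The nonconstant entry is real at
`t`, so `A² + B² ≠ 0` there and, after shrinking, on a disc. -/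
theorem exists_isLocalQuotient {N : ℂ → ℂ} {t : ℝ} (hN : MeromorphicNFAt N t)
    (hconj : ∀ z : ℂ, z.im ≠ 0 → N ((starRingEnd ℂ) z) = (starRingEnd ℂ) (N z)) :
    ∃ r > 0, ∃ A B, IsLocalQuotient N t r A B := by
  rcases meromorphicNFAt_iff_analyticAt_or.1 hN with h | ⟨hmer, hord, -⟩
  · have h1 : ∀ᶠ z in nhds (t : ℂ), AnalyticAt ℂ N z := h.eventually_analyticAt
    have h2 : ∀ᶠ z in nhds (t : ℂ), 1 + N z ^ 2 ≠ 0 :=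
      ((continuousAt_const.add (h.continuousAt.pow 2)).eventually_ne
        (one_add_sq_ne_zero_of_im_eq_zero (im_eq_zero_of_conj_symm h.continuousAt hconj)))
    obtain ⟨r, hr, H⟩ := Metric.eventually_nhds_iff_ball.1 (h1.and h2)
    refine ⟨r, hr, fun _ => 1, N, by fun_prop,
      fun z hz => (H z hz).1.differentiableAt.differentiableWithinAt,
      fun z hz => by simpa using (H z hz).2, by simp,
      fun u hu => im_eq_zero_of_conj_symm (H u hu).1.continuousAt hconj, by simp, by simp⟩
  · have hinv : AnalyticAt ℂ N⁻¹ t := by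
      rw [← hN.inv.meromorphicOrderAt_nonneg_iff_analyticAt, meromorphicOrderAt_inv]
      obtain ⟨n, hn⟩ := WithTop.ne_top_iff_exists.1 (hord.trans_le le_top).ne
      rw [← hn] at hord ⊢
      have hn0 : n < 0 := by exact_mod_cast hord
      rw [← WithTop.LinearOrderedAddCommGroup.coe_neg]
      exact_mod_cast (neg_pos.2 hn0).le
    have hconj' : ∀ z : ℂ, z.im ≠ 0 → N⁻¹ ((starRingEnd ℂ) z) = (starRingEnd ℂ) (N⁻¹ z) :=
      fun z hz => by simp [hconj z hz]
    have h1 : ∀ᶠ z in nhds (t : ℂ), AnalyticAt ℂ N⁻¹ z := hinv.eventually_analyticAt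
    have h2 : ∀ᶠ z in nhds (t : ℂ), 1 + N⁻¹ z ^ 2 ≠ 0 :=
      ((continuousAt_const.add (hinv.continuousAt.pow 2)).eventually_ne
        (one_add_sq_ne_zero_of_im_eq_zero (im_eq_zero_of_conj_symm hinv.continuousAt hconj')))
    have h3 : ∀ᶠ z : ℂ in nhds (t : ℂ), z ≠ t → N z ≠ 0 :=
      eventually_nhdsWithin_iff.1
        ((meromorphicOrderAt_ne_top_iff_eventually_ne_zero hmer).1 (hord.trans_le le_top).ne)
    obtain ⟨r, hr, H⟩ := Metric.eventually_nhds_iff_ball.1 (h1.and (h2.and h3))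
    refine ⟨r, hr, N⁻¹, fun _ => 1,
      fun z hz => (H z hz).1.differentiableAt.differentiableWithinAt, by fun_prop,
      fun z hz => by simpa [add_comm] using (H z hz).2.1,
      fun u hu => im_eq_zero_of_conj_symm (H u hu).1.continuousAt hconj', by simp,
      fun z hz hne => inv_ne_zero ((H z hz).2.2 hne),
      fun z hz hne => (mul_inv_cancel₀ ((H z hz).2.2 hne)).symm⟩

/-- A primitive, real on the real axis, of a function that is real on the real axis and holomorphic
on a family of discs centered at the real points. -/
theorem exists_primitive_of_real {G : ℂ → ℂ} {r : ℝ → ℝ} (hr : ∀ t, 0 < r t)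
    (hG : ∀ t : ℝ, DifferentiableOn ℂ G (Metric.ball t (r t))) (hreal : ∀ t : ℝ, (G t).im = 0)
    (θ₀ : ℝ) : ∃ θ : ℂ → ℂ, (∀ t : ℝ, ∀ z ∈ Metric.ball (t : ℂ) (r t), HasDerivAt θ (G z) z) ∧
      (∀ t : ℝ, (θ t).im = 0) ∧ θ 0 = θ₀ := by
  have hGc : Continuous fun u : ℝ => G u := continuous_iff_continuousAt.2 fun t =>
    ((hG t).differentiableAt (Metric.ball_mem_nhds _ (hr t))).continuousAt.comp
      Complex.continuous_ofReal.continuousAt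
  let F : ℝ → ℂ := fun t => θ₀ + ∫ u in (0 : ℝ)..t, G u
  -- Integrate along the real axis to `Re z`, then vertically. For `z` in a disc centred at a real
  -- `t`, the path from `t` to `z` stays in that disc, so `θ` is the local primitive with value `F
  -- t` at `t`.
  let θ : ℂ → ℂ := fun z =>
    F z.re + Complex.I * ∫ y in (0 : ℝ)..z.im, G (z.re + y * Complex.I)
  have key : ∀ t : ℝ, ∃ P : ℂ → ℂ, (∀ z ∈ Metric.ball (t : ℂ) (r t), HasDerivAt P (G z) z) ∧
      ∀ z ∈ Metric.ball (t : ℂ) (r t), θ z = P z := by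
    intro t
    obtain ⟨P, hPt, hP⟩ := (hG t).isExactOn_ball.with_val_at t (F t)
    refine ⟨P, hP, fun z hz => ?_⟩
    have hball : ∀ u y : ℝ, |u - t| ≤ |z.re - t| → |y| ≤ |z.im| →
        (u + y * Complex.I : ℂ) ∈ Metric.ball (t : ℂ) (r t) := by
      intro u y hu hy
      rw [mem_ball_iff_norm] at hz ⊢
      refine lt_of_le_of_lt ?_ hz
      rw [Complex.norm_def, Complex.norm_def]
      apply Real.sqrt_le_sqrt
      have h1 := sq_le_sq' (by linarith [abs_nonneg (u - t), abs_nonneg (z.re - t)]) hu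
      have h2 := sq_le_sq' (by linarith [abs_nonneg y, abs_nonneg z.im]) hy
      rw [sq_abs, sq_abs] at h1 h2
      simp only [Complex.normSq_apply, Complex.sub_re, Complex.add_re, Complex.mul_re,
        Complex.ofReal_re, Complex.ofReal_im, Complex.I_re, Complex.I_im, Complex.sub_im,
        Complex.add_im, Complex.mul_im]
      nlinarith
    have habs : ∀ u ∈ uIcc t z.re, |u - t| ≤ |z.re - t| := fun u hu =>
      abs_sub_left_of_mem_uIcc hu
    have habs0 : ∀ y ∈ uIcc 0 z.im, |y| ≤ |z.im| := fun y hy => by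
      simpa using abs_sub_left_of_mem_uIcc hy
    have e1 : ∫ u in t..z.re, G u = P z.re - P t := by
      have hmem : ∀ u ∈ uIcc t z.re, (u : ℂ) ∈ Metric.ball (t : ℂ) (r t) := fun u hu => by
        simpa using hball u 0 (habs u hu) (by simp)
      exact intervalIntegral.integral_eq_sub_of_hasDerivAt
        (fun u hu => (hP u (hmem u hu)).comp_ofReal) (hGc.intervalIntegrable _ _)
    have e2 : ∫ y in (0 : ℝ)..z.im, Complex.I * G (z.re + y * Complex.I) =
        P (z.re + z.im * Complex.I) - P (z.re + (0 : ℝ) * Complex.I) := by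
      have hmem : ∀ y ∈ uIcc 0 z.im, (z.re + y * Complex.I : ℂ) ∈ Metric.ball (t : ℂ) (r t) :=
        fun y hy => hball z.re y le_rfl (habs0 y hy)
      refine intervalIntegral.integral_eq_sub_of_hasDerivAt
        (f := fun y : ℝ => P (z.re + y * Complex.I)) (fun y hy => ?_) ?_
      · have h1 : HasDerivAt (fun y : ℝ => (z.re + y * Complex.I : ℂ)) Complex.I y := by
          simpa using ((Complex.ofRealCLM.hasDerivAt (x := y)).mul_const Complex.I).const_add
            (z.re : ℂ)
        rw [mul_comm]
        exact (hP _ (hmem y hy)).comp y h1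
      · refine (continuousOn_const.mul ((hG t).continuousOn.comp ?_ hmem)).intervalIntegrable
        fun_prop
    rw [intervalIntegral.integral_const_mul, Complex.re_add_im] at e2
    have e3 : F z.re = P z.re := by
      have h1 : F z.re = F t + ∫ u in t..z.re, G u := by
        simp only [F]
        rw [add_assoc, intervalIntegral.integral_add_adjacent_intervals
          (hGc.intervalIntegrable _ _) (hGc.intervalIntegrable _ _)]
      rw [h1, e1, hPt]; ring
    simp only [θ]
    rw [e2, e3]
    simp
  have hθt : ∀ t : ℝ, θ t = F t := fun t => by simp [θ]
  refine ⟨θ, fun t z hz => ?_, fun t => ?_, ?_⟩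
  · obtain ⟨P, hP, hθ⟩ := key t
    refine (hP z hz).congr_of_eventuallyEq ?_
    filter_upwards [Metric.isOpen_ball.mem_nhds hz] with w hw using hθ w hw
  · have h1 : (∫ u in (0 : ℝ)..t, G u).im = ∫ u in (0 : ℝ)..t, (G u).im := by
      have := Complex.imCLM.intervalIntegral_comp_comm (hGc.intervalIntegrable (μ := volume) 0 t)
      simpa using this.symm
    rw [hθt]
    simp [F, h1, hreal]
  · have := hθt 0
    simpa [F] using this

/-! ### The angle of a local quotient. -/

namespace IsLocalQuotient

variable {N : ℂ → ℂ} {t r : ℝ} {A B : ℂ → ℂ}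

theorem mono (h : IsLocalQuotient N t r A B) {r' : ℝ} (hr : r' ≤ r) :
    IsLocalQuotient N t r' A B := by
  have hsub := Metric.ball_subset_ball (x := (t : ℂ)) hr
  exact ⟨h.1.mono hsub, h.2.mono hsub, fun z hz => h.3 z (hsub hz), fun u hu => h.4 u (hsub hu),
    fun u hu => h.5 u (hsub hu), fun z hz => h.6 z (hsub hz), fun z hz => h.7 z (hsub hz)⟩

theorem differentiableAt_left (h : IsLocalQuotient N t r A B) {z : ℂ}
    (hz : z ∈ Metric.ball (t : ℂ) r) : DifferentiableAt ℂ A z :=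
  h.differentiableOn_left.differentiableAt (Metric.isOpen_ball.mem_nhds hz)

theorem differentiableAt_right (h : IsLocalQuotient N t r A B) {z : ℂ}
    (hz : z ∈ Metric.ball (t : ℂ) r) : DifferentiableAt ℂ B z :=
  h.differentiableOn_right.differentiableAt (Metric.isOpen_ball.mem_nhds hz)

/-- The derivative of `arctan (B / A)`. -/
noncomputable def arctanDeriv (A B : ℂ → ℂ) (z : ℂ) : ℂ :=
  (A z * deriv B z - deriv A z * B z) / (A z ^ 2 + B z ^ 2)

theorem differentiableOn_arctanDeriv (h : IsLocalQuotient N t r A B) :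
    DifferentiableOn ℂ (arctanDeriv A B) (Metric.ball t r) := by
  have hA := h.differentiableOn_left
  have hB := h.differentiableOn_right
  have hA' := hA.deriv Metric.isOpen_ball
  have hB' := hB.deriv Metric.isOpen_ball
  exact ((hA.mul hB').sub (hA'.mul hB)).div ((hA.pow 2).add (hB.pow 2)) h.ne_zero

/-- Away from the centre the right side does not depend on the choice of `A` and `B`; at the centre
it stays regular even if `N` has a pole. -/
theorem arctanDeriv_eq (h : IsLocalQuotient N t r A B) {z : ℂ} (hz : z ∈ Metric.ball (t : ℂ) r)
    (hne : z ≠ t) : deriv N z / (1 + N z ^ 2) = arctanDeriv A B z := by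
  have hA0 := h.left_ne_zero z hz hne
  have h1 : N =ᶠ[nhds z] fun w => B w / A w := by
    filter_upwards [Metric.isOpen_ball.mem_nhds hz, isOpen_ne.mem_nhds hne] with w hw hw'
    rw [h.eq_mul w hw hw', mul_div_cancel_right₀ _ (h.left_ne_zero w hw hw')]
  have h2 := (((h.differentiableAt_right hz).hasDerivAt).fun_div
    ((h.differentiableAt_left hz).hasDerivAt) hA0).deriv
  rw [h1.deriv_eq, h1.eq_of_nhds, h2, arctanDeriv]
  have h3 := h.ne_zero z hz
  have h4 : 1 + (B z / A z) ^ 2 = (A z ^ 2 + B z ^ 2) / A z ^ 2 := by field_simp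
  rw [h4]
  field_simp

theorem im_arctanDeriv (h : IsLocalQuotient N t r A B) (hr : 0 < r) :
    (arctanDeriv A B t).im = 0 := by
  have ht := Metric.mem_ball_self (x := (t : ℂ)) hr
  have hev : ∀ᶠ u : ℝ in nhds t, (u : ℂ) ∈ Metric.ball (t : ℂ) r :=
    Complex.continuous_ofReal.continuousAt.eventually (Metric.isOpen_ball.mem_nhds ht)
  have h1 := Complex.conj_eq_iff_im.2 (h.real_left t ht)
  have h2 := Complex.conj_eq_iff_im.2 (h.real_right t ht)
  have h3 := Complex.conj_eq_iff_im.2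
    (im_deriv_eq_zero (h.differentiableAt_left ht) (hev.mono h.real_left))
  have h4 := Complex.conj_eq_iff_im.2
    (im_deriv_eq_zero (h.differentiableAt_right ht) (hev.mono h.real_right))
  rw [← Complex.conj_eq_iff_im, arctanDeriv]
  simp only [map_div₀, map_sub, map_mul, map_add, map_pow, h1, h2, h3, h4]

/-- If `θ` is a primitive of the derivative of `arctan (B / A)` with the right initial value, then
`tan θ = B / A`. -/
theorem sin_mul_eq (h : IsLocalQuotient N t r A B) {θ : ℂ → ℂ}
    (hθ : ∀ z ∈ Metric.ball (t : ℂ) r, HasDerivAt θ (arctanDeriv A B z) z)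
    (h0 : Complex.sin (θ t) * A t = Complex.cos (θ t) * B t) {z : ℂ}
    (hz : z ∈ Metric.ball (t : ℂ) r) :
    Complex.sin (θ z) * A z = Complex.cos (θ z) * B z := by
  have hA := h.differentiableOn_left
  have hB := h.differentiableOn_right
  have hα : DifferentiableOn ℂ
      (fun z => (A z * deriv A z + B z * deriv B z) / (A z ^ 2 + B z ^ 2)) (Metric.ball t r) :=
    ((hA.mul (hA.deriv Metric.isOpen_ball)).add (hB.mul (hB.deriv Metric.isOpen_ball))).div
      ((hA.pow 2).add (hB.pow 2)) h.ne_zero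
  obtain ⟨p, hp⟩ := hα.isExactOn_ball
  -- If `A = ρ cos ω` and `B = ρ sin ω`, the first factor is `ρ sin (θ - ω)` with `θ' = ω'`. Since
  -- `p' = ρ' / ρ`, the exponential cancels `ρ` up to a constant.
  let F : ℂ → ℂ := fun z => (Complex.sin (θ z) * A z - Complex.cos (θ z) * B z) *
    Complex.exp (-p z)
  have hF : ∀ z ∈ Metric.ball (t : ℂ) r, HasDerivAt F 0 z := by
    intro z hz
    have h1 := (h.differentiableAt_left hz).hasDerivAt
    have h2 := (h.differentiableAt_right hz).hasDerivAt
    have h3 := ((((hθ z hz).csin.mul h1).sub ((hθ z hz).ccos.mul h2)).mul (hp z hz).neg.cexp)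
    refine h3.congr_deriv ?_
    have h4 := h.ne_zero z hz
    simp only [arctanDeriv, Pi.sub_apply, Pi.mul_apply, Pi.neg_apply]
    field_simp
    ring
  have hF0 : F t = 0 := by simp [F, h0]
  have hFz : F z = F t := by
    have hr : 0 < r := Metric.pos_of_mem_ball hz
    refine (convex_ball (t : ℂ) r).is_const_of_fderivWithin_eq_zero (𝕜 := ℂ)
      (fun w hw => (hF w hw).differentiableAt.differentiableWithinAt) (fun w hw => ?_) hz
      (Metric.mem_ball_self hr)
    rw [fderivWithin_of_isOpen Metric.isOpen_ball hw]
    ext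
    simp [(hF w hw).deriv]
  rw [hF0] at hFz
  exact sub_eq_zero.1 ((mul_eq_zero.1 hFz).resolve_right (Complex.exp_ne_zero _))

end IsLocalQuotient

open IsLocalQuotient in
/-- A meromorphic function that is real on the real axis is, near the real axis, a quotient of
holomorphic functions without common zeros that are real on the real axis. -/
theorem MeromorphicOnPlane.exists_quotient {f : ℂ → ℂ} (hm : MeromorphicOnPlane f)
    (hf : DifferentiableOn ℂ f {z | z.im ≠ 0})
    (hconj : ∀ z : ℂ, z.im ≠ 0 → f ((starRingEnd ℂ) z) = (starRingEnd ℂ) (f z)) :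
    ∃ (O : Set ℂ) (A B : ℂ → ℂ), IsOpen O ∧ (∀ t : ℝ, (t : ℂ) ∈ O) ∧ AnalyticOnNhd ℂ A O ∧
      AnalyticOnNhd ℂ B O ∧ (∀ z ∈ O, A z ≠ 0 ∨ B z ≠ 0) ∧
      (∀ t : ℝ, (A t).im = 0 ∧ (B t).im = 0) ∧ ∀ z ∈ O, z.im ≠ 0 → B z = f z * A z := by
  obtain ⟨M, hM, hMf⟩ := hm
  have hopen : IsOpen {z : ℂ | z.im ≠ 0} := isOpen_ne_fun Complex.continuous_im continuous_const
  have hMo : MeromorphicOn M univ := fun z _ => hM z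
  -- The normal form corrects the values of `M` at isolated points; off the real axis it coincides
  -- with the holomorphic `f`.
  set N := toMeromorphicNFOn M univ with hNdef
  have hNF : ∀ z, MeromorphicNFAt N z := fun z =>
    meromorphicNFOn_toMeromorphicNFOn M univ (mem_univ z)
  have hNf : ∀ z : ℂ, z.im ≠ 0 → N =ᶠ[nhds z] f := by
    intro z hz
    have h1 : M =ᶠ[nhds z] f := by
      filter_upwards [hopen.mem_nhds hz] with w hw using hMf w hw
    have h2 : AnalyticAt ℂ f z := hf.analyticAt (hopen.mem_nhds hz)
    exact ((hNF z).eventuallyEq_nhdsNE_iff_eventuallyEq_nhds h2.meromorphicNFAt).1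
      ((hMo.toMeromorphicNFOn_eq_self_on_nhdsNE (mem_univ z)).trans
        (h1.filter_mono nhdsWithin_le_nhds))
  have hNconj : ∀ z : ℂ, z.im ≠ 0 → N ((starRingEnd ℂ) z) = (starRingEnd ℂ) (N z) := by
    intro z hz
    rw [(hNf z hz).eq_of_nhds, (hNf _ (by simpa using hz)).eq_of_nhds, hconj z hz]
  have hNm : Meromorphic N := fun z => (hNF z).meromorphicAt
  have hg : MeromorphicOn (fun z => deriv N z / (1 + N z ^ 2)) univ := fun z _ =>
    (hNm.deriv z).div ((MeromorphicAt.const 1 z).add ((hNm z).pow 2))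
  -- One global function that equals each local `arctanDeriv` near the real axis, so the local
  -- derivatives need no gluing.
  set G := toMeromorphicNFOn (fun z => deriv N z / (1 + N z ^ 2)) univ with hGdef
  have hloc : ∀ t : ℝ, ∃ r > 0, ∃ A B, IsLocalQuotient N t r A B ∧
      EqOn G (arctanDeriv A B) (Metric.ball t r) := by
    intro t
    obtain ⟨r, hr, A, B, h⟩ := exists_isLocalQuotient (hNF t) hNconj
    have h1 : AnalyticAt ℂ (arctanDeriv A B) t :=
      h.differentiableOn_arctanDeriv.analyticAt (Metric.ball_mem_nhds _ hr)
    have h2 : (fun z => deriv N z / (1 + N z ^ 2)) =ᶠ[nhdsWithin (t : ℂ) {(t : ℂ)}ᶜ]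
        arctanDeriv A B := by
      filter_upwards [nhdsWithin_le_nhds (Metric.ball_mem_nhds (t : ℂ) hr), self_mem_nhdsWithin]
        with z hz hne using h.arctanDeriv_eq hz hne
    have h3 : G =ᶠ[nhds (t : ℂ)] arctanDeriv A B :=
      (MeromorphicNFAt.eventuallyEq_nhdsNE_iff_eventuallyEq_nhds
        (meromorphicNFOn_toMeromorphicNFOn _ univ (mem_univ _)) h1.meromorphicNFAt).1
        ((hg.toMeromorphicNFOn_eq_self_on_nhdsNE (mem_univ _)).trans h2)
    obtain ⟨ρ, hρ, H⟩ := Metric.eventually_nhds_iff_ball.1 h3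
    exact ⟨min r ρ, lt_min hr hρ, A, B, h.mono (min_le_left _ _),
      fun z hz => H z (Metric.ball_subset_ball (min_le_right _ _) hz)⟩
  choose r hr A B hAB hG using hloc
  have h00 : ((0 : ℝ) : ℂ) ∈ Metric.ball ((0 : ℝ) : ℂ) (r 0) := Metric.mem_ball_self (hr 0)
  -- The argument of `A + iB` at `0` is the initial angle; this also covers a pole at `0`, where `A`
  -- vanishes.
  set w : ℂ := (A 0 (0 : ℝ)).re + (B 0 (0 : ℝ)).re * Complex.I with hw
  obtain ⟨θ, hθ, hθreal, hθ0⟩ := exists_primitive_of_real hr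
    (fun t => (hAB t).differentiableOn_arctanDeriv.congr (hG t))
    (fun t => by rw [hG t (Metric.mem_ball_self (hr t))]; exact (hAB t).im_arctanDeriv (hr t))
    w.arg
  have hinit : Complex.sin (θ (0 : ℝ)) * A 0 (0 : ℝ) = Complex.cos (θ (0 : ℝ)) * B 0 (0 : ℝ) := by
    have hAr : A 0 (0 : ℝ) = ((A 0 (0 : ℝ)).re : ℂ) :=
      Complex.ext rfl ((hAB 0).real_left 0 h00)
    have hBr : B 0 (0 : ℝ) = ((B 0 (0 : ℝ)).re : ℂ) :=
      Complex.ext rfl ((hAB 0).real_right 0 h00)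
    have h1 := Complex.norm_mul_cos_arg w
    have h2 := Complex.norm_mul_sin_arg w
    have h3 : w.re = (A 0 (0 : ℝ)).re := by simp [hw]
    have h4 : w.im = (B 0 (0 : ℝ)).re := by simp [hw]
    rw [hAr, hBr, ← h3, ← h4, ← h1, ← h2, Complex.ofReal_zero, hθ0]
    push_cast
    ring
  let O : Set ℂ := ⋃ t : ℝ, Metric.ball (t : ℂ) (r t)
  have hO : IsOpen O := isOpen_iUnion fun t => Metric.isOpen_ball
  have hθd : DifferentiableOn ℂ θ O := fun z hz => by
    obtain ⟨t, ht⟩ := mem_iUnion.1 hz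
    exact (hθ t z ht).differentiableAt.differentiableWithinAt
  have hcos : AnalyticOnNhd ℂ (fun z => Complex.cos (θ z)) O :=
    hθd.ccos.analyticOnNhd hO
  have hsin : AnalyticOnNhd ℂ (fun z => Complex.sin (θ z)) O :=
    hθd.csin.analyticOnNhd hO
  have hrealO : ∀ t : ℝ, (t : ℂ) ∈ O := fun t => mem_iUnion.2 ⟨t, Metric.mem_ball_self (hr t)⟩
  -- Every disc of the union meets the real line.
  have hconn : IsPreconnected O := by
    refine isPreconnected_of_forall 0 fun y hy => ?_
    obtain ⟨t, ht⟩ := mem_iUnion.1 hy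
    refine ⟨range ((↑) : ℝ → ℂ) ∪ Metric.ball (t : ℂ) (r t), ?_, Or.inl ⟨0, by simp⟩,
      Or.inr ht, ?_⟩
    · refine union_subset ?_ (subset_iUnion (fun t : ℝ => Metric.ball (t : ℂ) (r t)) t)
      rintro _ ⟨u, rfl⟩
      exact hrealO u
    · exact (isPreconnected_range Complex.continuous_ofReal).union (t : ℂ) ⟨t, rfl⟩
        (Metric.mem_ball_self (hr t)) (convex_ball _ _).isPreconnected
  -- `sin θ = N cos θ` is obtained near `0` only; the identity theorem for meromorphic functions
  -- spreads it over the connected set `O`.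
  let D : ℂ → ℂ := fun z => Complex.sin (θ z) - N z * Complex.cos (θ z)
  have hD : MeromorphicOn D O := fun z hz =>
    (hsin z hz).meromorphicAt.sub ((hNm z).mul (hcos z hz).meromorphicAt)
  have hD0 : meromorphicOrderAt D ((0 : ℝ) : ℂ) = ⊤ := by
    rw [meromorphicOrderAt_eq_top_iff]
    filter_upwards [nhdsWithin_le_nhds (Metric.ball_mem_nhds ((0 : ℝ) : ℂ) (hr 0)),
      self_mem_nhdsWithin] with z hz hne
    have h1 := (hAB 0).sin_mul_eq (fun z hz => by rw [← hG 0 hz]; exact hθ 0 z hz) hinit hz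
    rw [(hAB 0).eq_mul z hz hne, ← mul_assoc] at h1
    have h2 := mul_right_cancel₀ ((hAB 0).left_ne_zero z hz hne) h1
    simp only [D]
    rw [h2]; ring
  refine ⟨O, fun z => Complex.cos (θ z), fun z => Complex.sin (θ z), hO, hrealO, hcos, hsin,
    fun z _ => ?_, fun t => ?_, fun z hz hzim => ?_⟩
  · by_contra! H
    have := Complex.sin_sq_add_cos_sq (θ z)
    rw [H.1, H.2] at this
    simp at this
  · have h1 : θ t = ((θ t).re : ℂ) := Complex.ext rfl (hθreal t)
    beta_reduce
    rw [h1]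
    exact ⟨Complex.cos_ofReal_im _, Complex.sin_ofReal_im _⟩
  · have h1 : meromorphicOrderAt D z = ⊤ := by
      by_contra H
      exact hD.meromorphicOrderAt_ne_top_of_isPreconnected hconn hz (hrealO 0) H hD0
    rw [meromorphicOrderAt_eq_top_iff] at h1
    have hfa : AnalyticAt ℂ N z := by
      rw [analyticAt_congr (hNf z hzim)]
      exact hf.analyticAt (hopen.mem_nhds hzim)
    have h2 : ContinuousAt D z := ((hsin z hz).sub (hfa.mul (hcos z hz))).continuousAt
    have h3 : D z = 0 := tendsto_nhds_unique (h2.tendsto.mono_left nhdsWithin_le_nhds)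
      (tendsto_const_nhds.congr' (h1.mono fun _ h => h.symm))
    rw [← (hNf z hzim).eq_of_nhds]
    exact sub_eq_zero.1 h3

/-! ### The two implications. -/

theorem IsSchrodingerSolution.im_eq_zero_of_initial {a : ℝ} {V : ℝ → ℝ}
    (hV : LocallyIntegrableOn V (Ioi a)) {x₀ : ℝ} (hx₀ : a < x₀) {t : ℝ} {ψ : ℝ → ℂ}
    (hψ : IsSchrodingerSolution a V t ψ) (h0 : (ψ x₀).im = 0) (h1 : (deriv ψ x₀).im = 0)
    {x : ℝ} (hx : a < x) : (ψ x).im = 0 := by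
  have hc := hψ.conj
  rw [Complex.conj_ofReal] at hc
  refine Complex.conj_eq_iff_im.1 (hc.eqOn_of_initial hV hx₀ hψ ?_ ?_ hx)
  · exact Complex.conj_eq_iff_im.2 h0
  · rw [hψ.deriv_conj hx₀]
    exact Complex.conj_eq_iff_im.2 h1

namespace IsFundamentalSystem

variable {a : ℝ} {V : ℝ → ℝ} {x₀ : ℝ} {c s : ℂ → ℝ → ℂ}

theorem hasAnalyticWeylSolution (F : IsFundamentalSystem a V x₀ c s)
    (hV : LocallyIntegrableOn V (Ioi a)) (hlp : LimitPointLeft a V)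
    (hm : MeromorphicOnPlane (fun z => weylMLeft a V z x₀)) : HasAnalyticWeylSolution a V := by
  obtain ⟨O, A, B, hO, hreal, hA, hB, hne, him, hAB⟩ :=
    hm.exists_quotient (F.differentiableOn_weylMLeft hlp) fun z hz => F.weylMLeft_conj hlp hz
  refine ⟨O, fun z x => A z * c z x + B z * s z x, hO, hreal,
    fun z hz => ⟨F.sol_lincomb z (A z) (B z), ?_⟩, fun x hx z hz => ?_, fun t x hx => ?_,
    1, one_pos, fun z hz hzim _ => ?_⟩
  · by_cases h : A z = 0
    · obtain ⟨x, hx, hsx⟩ := F.exists_s_ne_zero z F.lt (lt_add_one x₀)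
      refine ⟨x, F.lt.trans hx.1, ?_⟩
      beta_reduce
      rw [h, zero_mul, zero_add]
      exact mul_ne_zero ((hne z hz).resolve_left (not_not.2 h)) hsx
    · exact ⟨x₀, F.lt, by simpa [F.c_self, F.s_self] using h⟩
  · exact ((hA z hz).mul ((F.differentiable_c x hx).analyticAt z)).add
      ((hB z hz).mul ((F.differentiable_s x hx).analyticAt z))
  · have h1 := (F.sol_c t).im_eq_zero_of_initial hV F.lt (by simp [F.c_self])
      (by simp [F.deriv_c_self]) hx
    have h2 := (F.sol_s t).im_eq_zero_of_initial hV F.lt (by simp [F.s_self])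
      (by simp [F.deriv_s_self]) hx
    simp [h1, h2, (him t).1, (him t).2]
  · refine ((F.weylMLeft_spec hzim).const_mul (A z)).congr fun x _ => ?_
    beta_reduce
    rw [hAB z hz hzim]
    ring

/-- Analyticity in `z` is assumed for values only. With `s(w, y) ≠ 0`, the derivative at `x₀` is
recovered from the values at `x₀` and `y`. -/
theorem analyticAt_deriv (F : IsFundamentalSystem a V x₀ c s) {O : Set ℂ} {φ : ℂ → ℝ → ℂ}
    (hO : IsOpen O) (hφ : ∀ z ∈ O, IsSchrodingerSolution a V z (φ z))
    (han : ∀ x, a < x → AnalyticOnNhd ℂ (fun z => φ z x) O) {w : ℂ} (hw : w ∈ O) :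
    AnalyticAt ℂ (fun z => deriv (φ z) x₀) w := by
  obtain ⟨y, hy, hsy⟩ := F.exists_s_ne_zero w F.lt (lt_add_one x₀)
  have hya : a < y := F.lt.trans hy.1
  have hs : AnalyticAt ℂ (fun z => s z y) w := (F.differentiable_s y hya).analyticAt w
  have h1 : AnalyticAt ℂ (fun z => (φ z y - φ z x₀ * c z y) / s z y) w :=
    ((han y hya w hw).sub ((han x₀ F.lt w hw).mul ((F.differentiable_c y hya).analyticAt w))).div
      hs hsy
  refine h1.congr ?_
  filter_upwards [hO.mem_nhds hw, hs.continuousAt.eventually_ne hsy] with z hz hsz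
  rw [F.eq_lincomb (hφ z hz) hya]
  field_simp
  ring

theorem meromorphicOnPlane_weylMLeft (F : IsFundamentalSystem a V x₀ c s)
    (hlp : LimitPointLeft a V) (h : HasAnalyticWeylSolution a V) :
    MeromorphicOnPlane (fun z => weylMLeft a V z x₀) := by
  obtain ⟨O, φ, hO, hreal, hφ, han, -, ε, hε, hL2⟩ := h
  have hopen : IsOpen {z : ℂ | z.im ≠ 0} := isOpen_ne_fun Complex.continuous_im continuous_const
  -- With `φ' / φ` as value on the axis, the extension equals this quotient throughout a
  -- neighbourhood of each real point.
  refine ⟨fun z => open Classical in if z.im ≠ 0 then weylMLeft a V z x₀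
    else deriv (φ z) x₀ / φ z x₀, fun w => ?_, fun z hz => if_pos hz⟩
  by_cases hw : w.im = 0
  · have hwO : w ∈ O := by
      have : w = (w.re : ℂ) := Complex.ext rfl hw
      rw [this]
      exact hreal _
    have h1 : MeromorphicAt (fun z => deriv (φ z) x₀ / φ z x₀) w :=
      (F.analyticAt_deriv hO (fun z hz => (hφ z hz).1) han hwO).meromorphicAt.div
        (han x₀ F.lt w hwO).meromorphicAt
    refine h1.congr (Filter.EventuallyEq.filter_mono ?_ nhdsWithin_le_nhds)
    have h2 : ∀ᶠ z : ℂ in nhds w, |z.im| < ε :=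
      Complex.continuous_im.abs.continuousAt.eventually_lt continuousAt_const (by simpa [hw])
    filter_upwards [hO.mem_nhds hwO, h2] with z hz hzε
    by_cases hz0 : z.im = 0
    · simp [hz0]
    · rw [if_pos hz0, F.weylMLeft_eq hlp hz0 (hφ z hz).1 (hL2 z hz hz0 hzε) (hφ z hz).2]
  · refine (((F.differentiableOn_weylMLeft hlp).analyticAt (hopen.mem_nhds hw)).congr
      ?_).meromorphicAt
    filter_upwards [hopen.mem_nhds hw] with z hz
    exact (if_pos hz).symm

end IsFundamentalSystem

theorem lemmal4p2 (a : ℝ) (V : ℝ → ℝ) (hV : LocallyIntegrableOn V (Ioi a))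
    (hleft : LimitPointLeft a V) (hinfty : LimitPointInfty a V) :
    HasAnalyticWeylSolution a V ↔
      ∀ x : ℝ, a < x → MeromorphicOnPlane (fun z => weylMLeft a V z x) := by
  constructor
  · intro h x hx
    obtain ⟨c, s, F⟩ := exists_isFundamentalSystem hV hx
    exact F.meromorphicOnPlane_weylMLeft hleft h
  · intro h
    -- Meromorphy at a single base point is enough for this direction.
    have hx : a < a + 1 := lt_add_one a
    obtain ⟨c, s, F⟩ := exists_isFundamentalSystem hV hx
    exact F.hasAnalyticWeylSolution hV hleft (h _ hx)
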